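/- Let $\Sigma$ be a finite alphabet. An input word $w\in\Sigma^*$ of length $n$ is written on a read-only tape with cells $0,1,\dots,n+1$, where cell $0$ holds a left endmarker, cells $1,\dots,n$ hold the letters of $w$, and cell $n+1$ holds a right endmarker; a move beyond an endmarker leaves the head in place. For $m\ge 0$, a deterministic $m$-pebble automaton consists of a finite set $Q$ of states, an initial state $q_0\in Q$, a set $A\subseteq Q$ of accepting states, and a transition function $$\delta: Q\times(\Sigma\cup\{\vdash,\dashv\})\times\mathcal P(\{1,\dots,m\})^2\to Q\times\mathcal P(\{1,\dots,m\})^2\times\{-1,0,1\}$$ such that $\delta(q,a,B,C)=(p,D,K,\varepsilon)$ with $B\cap C=\emptyset$ implies $D\cup K=B\cup C$ and $D\cap K=\emptyset$. It starts in state $q_0$ with its head on cell $0$ and all $m$ labeled pebbles available (off the tape). If the state is $q$, the scanned symbol is $a$, $B$ is the set of pebbles on the scanned cell, $C$ is the set of available pebbles and $\delta(q,a,B,C)=(p,D,K,\varepsilon)$, then the automaton changes its state to $p$, makes $D$ the set of pebbles on the scanned cell and $K$ the set of available pebbles (pebbles on other cells stay there), and moves its head by $\varepsilon$. It accepts $w$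 if its computation on $w$ reaches an accepting state. A nondeterministic $m$-pebble automaton is defined in the same way, with a set of possible transitions (each subject to the same condition) in place of the single value of $\delta$; it accepts $w$ if some computation on $w$ reaches an accepting state. Let $\mathcal{REG}_m$ and $\mathcal{NREG}_m$ be the classes of languages over $\Sigma$ accepted by deterministic and by nondeterministic $m$-pebble automata, respectively. Let $\mathcal L$ (Logspace) and $\mathcal{NL}$ be the classes of languages over $\Sigma$ accepted by deterministic, respectively nondeterministic, Turing machines that have a read-only two-way input tape as above and finitely many read-write work tapes over a finite work alphabet, and that visit $O(\log n)$ work-tape cells in every computation on every input of length $n$; here too, a word is accepted if some computation on it reaches an accepting state. Then $$\mathcal L=\bigcup_{m\ge 0}\mathcal{REG}_m\qquad\text{and}\qquad \mathcal{NL}=\bigcup_{m\ge 0}\mathcal{NREG}_m .$$ -/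

import Mathlib

namespace PebbleLogspace

/-- The contents of a cell of the input tape: the input word is enclosed between two endmarkers. -/
inductive Symbol (α : Type*) where
  | leftEnd : Symbol α
  | letter (a : α) : Symbol α
  | rightEnd : Symbol α

/-- The directions `-1`, `0`, `1` in which a head can move. -/
inductive Move where
  | left : Move
  | stay : Move
  | right : Move

/-- The cells of the read-only tape that holds `w`: cell `0` is the left endmarker, the cells
`1, …, |w|` hold the letters of `w`, and cell `|w| + 1` is the right endmarker. -/
abbrev Cell {α : Type*} (w : List α) : Type := Fin (w.length + 2)

/-- The symbol in a cell of the input tape. -/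
def scan {α : Type*} (w : List α) (i : Cell w) : Symbol α :=
  if i.val = 0 then Symbol.leftEnd
  else match w[i.val - 1]? with
    | some a => Symbol.letter a
    | none => Symbol.rightEnd

/-- Movement of the input head. A move beyond an endmarker leaves the head where it is. -/
def Move.onInput {α : Type*} {w : List α} : Move → Cell w → Cell w
  | Move.left, i => ⟨i.val - 1, by have := i.isLt; omega⟩
  | Move.stay, i => i
  | Move.right, i => ⟨min (i.val + 1) (w.length + 1), by omega⟩

/-- Movement of a head on a one-way infinite work tape with cells `0, 1, 2, …`. A move to the left
of cell `0` leaves the head where it is. -/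
def Move.onWork : Move → ℕ → ℕ
  | Move.left, i => i - 1
  | Move.stay, i => i
  | Move.right, i => i + 1

/-! ### Pebble automata -/

/-- A nondeterministic `k`-pebble automaton with input alphabet `α`. The transition
`(p, D, K, ε) ∈ δ q a B C` is possible when the state is `q`, the scanned symbol is `a`, the set of
pebbles on the scanned cell is `B` and the set of available pebbles (those not on the tape) is `C`.
It changes the state to `p`, redistributes the pebbles of `B ∪ C` so that those of `D` are on the
scanned cell and those of `K` are available, and then moves the head in direction `ε`. -/
structure PebbleAutomaton (α : Type*) (k : ℕ) where
  /-- The set of states. -/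
  Q : Type
  finite_Q : Finite Q
  /-- The initial state. -/
  start : Q
  /-- The set of accepting states. -/
  accept : Set Q
  /-- The transitions. -/
  δ : Q → Symbol α → Finset (Fin k) → Finset (Fin k) →
    Set (Q × Finset (Fin k) × Finset (Fin k) × Move)
  pebbles_preserved : ∀ q a B C, Disjoint B C → ∀ p D K ε, (p, D, K, ε) ∈ δ q a B C →
    D ∪ K = B ∪ C ∧ Disjoint D K

namespace PebbleAutomaton

/-- The automaton is deterministic if `δ` is (the graph of) a function. -/
def IsDeterministic {α : Type*} {k : ℕ} (M : PebbleAutomaton α k) : Prop :=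
  ∀ q a B C, ∃! r, r ∈ M.δ q a B C

/-- A configuration on input `w`. `pebble i` is the cell on which pebble `i` lies, or `none` if
pebble `i` is not on the tape. -/
structure Cfg {α : Type*} {k : ℕ} (M : PebbleAutomaton α k) (w : List α) where
  state : M.Q
  head : Cell w
  pebble : Fin k → Option (Cell w)

/-- The initial configuration: the head is on cell `0` and no pebble is on the tape. -/
def init {α : Type*} {k : ℕ} (M : PebbleAutomaton α k) (w : List α) : M.Cfg w where
  state := M.start
  head := 0
  pebble := fun _ => none

/-- The set of pebbles on the scanned cell. -/
def Cfg.here {α : Type*} {k : ℕ} {M : PebbleAutomaton α k} {w : List α} (c : M.Cfg w) :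
    Finset (Fin k) :=
  Finset.univ.filter fun i => c.pebble i = some c.head

/-- The set of available pebbles. -/
def Cfg.available {α : Type*} {k : ℕ} {M : PebbleAutomaton α k} {w : List α} (c : M.Cfg w) :
    Finset (Fin k) :=
  Finset.univ.filter fun i => c.pebble i = none

/-- One step of computation. -/
def Step {α : Type*} {k : ℕ} (M : PebbleAutomaton α k) (w : List α) (c c' : M.Cfg w) : Prop :=
  ∃ p D K ε, (p, D, K, ε) ∈ M.δ c.state (scan w c.head) c.here c.available ∧
    c'.state = p ∧
    c'.head = Move.onInput ε c.head ∧
    ∀ i, c'.pebble i = if i ∈ D then some c.head else if i ∈ K then none else c.pebble i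

/-- The accepted language: the words on which some computation reaches an accepting state. -/
def language {α : Type*} {k : ℕ} (M : PebbleAutomaton α k) : Language α :=
  {w | ∃ c : M.Cfg w, Relation.ReflTransGen (M.Step w) (M.init w) c ∧ c.state ∈ M.accept}

end PebbleAutomaton

/-- The languages over `α` accepted by deterministic `m`-pebble automata. -/
def REG (α : Type*) (m : ℕ) : Set (Language α) :=
  {L | ∃ M : PebbleAutomaton α m, M.IsDeterministic ∧ M.language = L}

/-- The languages over `α` accepted by nondeterministic `m`-pebble automata. -/
def NREG (α : Type*) (m : ℕ) : Set (Language α) :=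
  {L | ∃ M : PebbleAutomaton α m, M.language = L}

/-! ### Turing machines with a read-only input tape -/

/-- A nondeterministic Turing machine with input alphabet `α`, a read-only two-way input tape and
`k` one-way infinite read-write work tapes. The transition `(p, g, ε, η) ∈ δ q a f` is possible
when the state is `q`, the input head scans `a` and the `j`-th work head scans `f j`. It changes
the state to `p`, writes `g j` on the cell scanned on work tape `j`, and moves the input head in
direction `ε` and the `j`-th work head in direction `η j`. The machine halts when no transition is
possible. -/
structure TuringMachine (α : Type*) (k : ℕ) where
  /-- The set of states. -/
  Q : Type
  finite_Q : Finite Q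
  /-- The work alphabet. -/
  Γ : Type
  finite_Γ : Finite Γ
  /-- The blank symbol, which fills the work tapes at the start. -/
  blank : Γ
  /-- The initial state. -/
  start : Q
  /-- The set of accepting states. -/
  accept : Set Q
  /-- The transitions. -/
  δ : Q → Symbol α → (Fin k → Γ) → Set (Q × (Fin k → Γ) × Move × (Fin k → Move))

namespace TuringMachine

/-- The machine is deterministic if at most one transition is possible in every situation. -/
def IsDeterministic {α : Type*} {k : ℕ} (M : TuringMachine α k) : Prop :=
  ∀ q a f, (M.δ q a f).Subsingleton

/-- A configuration on input `w`. -/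
structure Cfg {α : Type*} {k : ℕ} (M : TuringMachine α k) (w : List α) where
  state : M.Q
  head : Cell w
  workHead : Fin k → ℕ
  tape : Fin k → ℕ → M.Γ

/-- The initial configuration: all heads are on cell `0` of their tapes, and the work tapes are
blank. -/
def init {α : Type*} {k : ℕ} (M : TuringMachine α k) (w : List α) : M.Cfg w where
  state := M.start
  head := 0
  workHead := fun _ => 0
  tape := fun _ _ => M.blank

/-- One step of computation. -/
def Step {α : Type*} {k : ℕ} (M : TuringMachine α k) (w : List α) (c c' : M.Cfg w) : Prop :=
  ∃ p g ε η, (p, g, ε, η) ∈ M.δ c.state (scan w c.head) (fun j => c.tape j (c.workHead j)) ∧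
    c'.state = p ∧
    c'.head = Move.onInput ε c.head ∧
    (∀ j, c'.workHead j = Move.onWork (η j) (c.workHead j)) ∧
    ∀ j, c'.tape j = Function.update (c.tape j) (c.workHead j) (g j)

/-- `c` occurs in some computation on input `w`. -/
def Reachable {α : Type*} {k : ℕ} (M : TuringMachine α k) (w : List α) (c : M.Cfg w) : Prop :=
  Relation.ReflTransGen (M.Step w) (M.init w) c

/-- The accepted language: the words on which some computation reaches an accepting state. -/
def language {α : Type*} {k : ℕ} (M : TuringMachine α k) : Language α :=
  {w | ∃ c : M.Cfg w, M.Reachable w c ∧ c.state ∈ M.accept}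

/-- The machine works in space `s`: in every computation on a word of length `n`, at most the first
`s n` cells of each work tape are visited. -/
def SpaceBound {α : Type*} {k : ℕ} (M : TuringMachine α k) (s : ℕ → ℕ) : Prop :=
  ∀ (w : List α) (c : M.Cfg w), M.Reachable w c → ∀ j, c.workHead j < s w.length

/-- The machine works in space `O(log n)`. The summand `1` only matters for words of length at
most `1`, for which `log n` is not positive. -/
def IsLogspace {α : Type*} {k : ℕ} (M : TuringMachine α k) : Prop :=
  ∃ b : ℕ, M.SpaceBound fun n => b * (Nat.log 2 n + 1)

end TuringMachine

/-- The class Logspace of languages over `α`. -/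
def LOGSPACE (α : Type*) : Set (Language α) :=
  {L | ∃ (k : ℕ) (M : TuringMachine α k), M.IsDeterministic ∧ M.IsLogspace ∧ M.language = L}

/-- The class NL of languages over `α`. -/
def NLOGSPACE (α : Type*) : Set (Language α) :=
  {L | ∃ (k : ℕ) (M : TuringMachine α k), M.IsLogspace ∧ M.language = L}

end PebbleLogspace

namespace PebbleLogspace

/-! Both inclusions are step-by-step simulations. Nondeterminism enters a simulator only where it
applies a transition of the simulated machine, so one construction per direction serves both
equalities. Simulators are while programs over an abstract device. A program has finitely many
residual programs, and these, paired with a finite memory, are the states of a genuine machine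
(`toPebble`, `toTuring`) that accepts exactly when the program can terminate
(`mem_language_toPebble`, `mem_language_toTuring`). By `exists_big_loop_iff` it then suffices that
one run of a loop body matches one step of the simulated machine, in both directions. Space bounds
concern every computation, terminating or not, so they need the separate small-step notion `Safe`.

From pebbles to logarithmic space: a position in `0, …, n + 1` has `O(log n)` binary digits. One
work tape stores the digits of the head position and of all pebble positions side by side, one
column per binary place. A sweep over the columns finds the pebbles lying under the head; a second
sweep copies the head position to the pebbles put down and adds or subtracts one with a carry
(`sweepResult_advance`). A column is appended only when the head position reaches a new power of
two, which bounds the space. The core is `PebbleAutomaton.Represents.simulateStep`.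

From logarithmic space to pebbles: a pebble on cell `c` is a register holding `c ≤ n + 1`, so it can
hold any `l`-bit number, where `l` is the integer part of the binary logarithm of `n + 2`. With
space `b (log n + 1)`, each work tape is cut into columns of constant width `2b + 1`, at most `l` of
them being visited. For each tape, each place in a column and each symbol, the marks of that symbol
form a string of `l` bits. The bits left and right of the scanned column are two stacks, coded in
binary by two registers, while the scanned bit is in the finite memory. Moving to the next column
pushes on one stack and pops from the other, that is, doubles one register and halves another with
the help of a scratch register (`big_push`, `big_pop`, `big_shift`). The core is
`TuringMachine.Represents.simulateStep`. -/

/-! ### While programs over an abstract device -/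

/-- A device with stores `S`: a program sees a store only through `obs`, and changes it only by the
actions in `A`. -/
structure Device (O A S : Type*) where
  obs : S → O
  act : A → S → S

/-- Perform an optional action. -/
def Device.run {O A S : Type*} (d : Device O A S) : Option A → S → S
  | none, s => s
  | some a, s => d.act a s

/-- Nondeterministic while programs with memory `F`, for devices with observations `O` and
actions `A`. -/
inductive Prog (F O A : Type*) where
  | skip : Prog F O A
  | act (f : F → O → Set (F × Option A)) : Prog F O A
  | seq (p q : Prog F O A) : Prog F O A
  | ite (t : F → O → Prop) (p q : Prog F O A) : Prog F O A
  | loop (t : F → O → Prop) (p : Prog F O A) : Prog F O A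

namespace Prog

variable {F O A S : Type*}

/-- The transitions of a program: `Next p m o p' m' a` says that with memory `m` and observation
`o` the program `p` can perform `a`, change the memory to `m'` and continue as `p'`. -/
inductive Next : Prog F O A → F → O → Prog F O A → F → Option A → Prop
  | act {f m o m' a} (h : (m', a) ∈ f m o) : Next (act f) m o skip m' a
  | seqSkip {q m o} : Next (seq skip q) m o q m none
  | seq {p q m o p' m' a} (h : Next p m o p' m' a) : Next (seq p q) m o (seq p' q) m' a
  | iteTrue {t p q m o} (h : t m o) : Next (ite t p q) m o p m none
  | iteFalse {t p q m o} (h : ¬ t m o) : Next (ite t p q) m o q m none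
  | loopTrue {t p m o} (h : t m o) : Next (loop t p) m o (seq p (loop t p)) m none
  | loopFalse {t p m o} (h : ¬ t m o) : Next (loop t p) m o skip m none

/-- One step of a program together with its memory and store. -/
def Step (d : Device O A S) (x y : Prog F O A × F × S) : Prop :=
  ∃ a, Next x.1 x.2.1 (d.obs x.2.2) y.1 y.2.1 a ∧ y.2.2 = d.run a x.2.2

/-- Big-step semantics: `Big d p s s'` says that `p`, started in `s`, can terminate in `s'`. -/
inductive Big (d : Device O A S) : Prog F O A → F × S → F × S → Prop
  | skip {s} : Big d skip s s
  | act {f m s m' a} (h : (m', a) ∈ f m (d.obs s)) : Big d (act f) (m, s) (m', d.run a s)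
  | seq {p q s s' s''} (h : Big d p s s') (h' : Big d q s' s'') : Big d (seq p q) s s''
  | iteTrue {t p q s s'} (h : t s.1 (d.obs s.2)) (h' : Big d p s s') : Big d (ite t p q) s s'
  | iteFalse {t p q s s'} (h : ¬ t s.1 (d.obs s.2)) (h' : Big d q s s') : Big d (ite t p q) s s'
  | loopTrue {t p s s' s''} (h : t s.1 (d.obs s.2)) (h' : Big d p s s')
      (h'' : Big d (loop t p) s' s'') : Big d (loop t p) s s''
  | loopFalse {t p s} (h : ¬ t s.1 (d.obs s.2)) : Big d (loop t p) s s

variable {d : Device O A S}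

theorem Step.seq {p p' : Prog F O A} {s s' : F × S} (q : Prog F O A)
    (h : Step d (p, s) (p', s')) : Step d (seq p q, s) (seq p' q, s') := by
  obtain ⟨a, h, h'⟩ := h
  exact ⟨a, .seq h, h'⟩

theorem reach_seq {p p' : Prog F O A} {s s' : F × S} (q : Prog F O A)
    (h : Relation.ReflTransGen (Step d) (p, s) (p', s')) :
    Relation.ReflTransGen (Step d) (seq p q, s) (seq p' q, s') :=
  h.lift (fun x : Prog F O A × F × S => (Prog.seq x.1 q, x.2)) fun _ _ h => Step.seq q h

theorem Big.reach {p : Prog F O A} {s s' : F × S} (h : Big d p s s') :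
    Relation.ReflTransGen (Step d) (p, s) (Prog.skip, s') := by
  induction h with
  | skip => exact .refl
  | act h => exact .single ⟨_, .act h, rfl⟩
  | seq _ _ ih ih' =>
    exact (reach_seq _ ih).trans (.head ⟨_, .seqSkip, rfl⟩ ih')
  | iteTrue h _ ih => exact .head ⟨_, .iteTrue h, rfl⟩ ih
  | iteFalse h _ ih => exact .head ⟨_, .iteFalse h, rfl⟩ ih
  | loopTrue h _ _ ih ih' =>
    exact .head ⟨_, .loopTrue h, rfl⟩ ((reach_seq _ ih).trans (.head ⟨_, .seqSkip, rfl⟩ ih'))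
  | loopFalse h => exact .single ⟨_, .loopFalse h, rfl⟩

/-- A single transition can be put in front of a terminating evaluation. Iterated backwards along a
computation, this turns small steps into a big step. -/
theorem Next.big {p p' : Prog F O A} {m m' : F} {a : Option A} {s : S} {r : F × S}
    (h : Next p m (d.obs s) p' m' a) (h' : Big d p' (m', d.run a s) r) : Big d p (m, s) r := by
  generalize ho : d.obs s = o at h
  induction h generalizing r with
  | act h => cases h'; subst ho; exact .act h
  | seqSkip => exact .seq .skip h'
  | seq _ ih =>
    cases h' with
    | seq h1 h2 => exact .seq (ih h1 ho) h2
  | iteTrue h => subst ho; exact .iteTrue h h'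
  | iteFalse h => subst ho; exact .iteFalse h h'
  | loopTrue h =>
    subst ho
    cases h' with
    | seq h1 h2 => exact .loopTrue h h1 h2
  | loopFalse h => subst ho; cases h'; exact .loopFalse h

/-- The small-step and the big-step semantics agree. -/
theorem reach_skip_iff {p : Prog F O A} {s s' : F × S} :
    Relation.ReflTransGen (Step d) (p, s) (skip, s') ↔ Big d p s s' := by
  refine ⟨fun h => ?_, Big.reach⟩
  generalize hx : (p, s) = x at h
  induction h using Relation.ReflTransGen.head_induction_on generalizing p s with
  | refl => cases hx; exact .skip
  | head h _ ih =>
    subst hx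
    rename_i y _
    obtain ⟨p', m', r'⟩ := y
    obtain ⟨a, h, h'⟩ := h
    dsimp only at h h'
    subst h'
    exact h.big (ih rfl)

theorem big_act {f : F → O → Set (F × Option A)} {s s' : F × S} :
    Big d (.act f) s s' ↔ ∃ a, (s'.1, a) ∈ f s.1 (d.obs s.2) ∧ s'.2 = d.run a s.2 := by
  constructor
  · intro h; cases h with | act h => exact ⟨_, h, rfl⟩
  · rintro ⟨a, h, h'⟩
    obtain ⟨m, s⟩ := s
    obtain ⟨m', s'⟩ := s'
    dsimp only at h h'
    subst h'
    exact .act h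

theorem big_seq {p q : Prog F O A} {s s' : F × S} :
    Big d (.seq p q) s s' ↔ ∃ r, Big d p s r ∧ Big d q r s' :=
  ⟨fun h => by cases h with | seq h₁ h₂ => exact ⟨_, h₁, h₂⟩, fun ⟨_, h₁, h₂⟩ => .seq h₁ h₂⟩

/-- A loop whose iterations run through the states `g 0, …, g n`. -/
theorem big_loop_of_sequence {t : F → O → Prop} {p : Prog F O A} (n : ℕ) (g : ℕ → F × S)
    (ht : ∀ i < n, t (g i).1 (d.obs (g i).2)) (hn : ¬ t (g n).1 (d.obs (g n).2))
    (hp : ∀ i < n, Big d p (g i) (g (i + 1))) : Big d (.loop t p) (g 0) (g n) := by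
  induction n generalizing g with
  | zero => exact .loopFalse hn
  | succ n ih =>
    exact .loopTrue (ht 0 n.succ_pos) (hp 0 n.succ_pos)
      (ih (fun i => g (i + 1)) (fun i hi => ht (i + 1) (by omega)) hn
        fun i hi => hp (i + 1) (by omega))

/-- Run `p x` for the elements `x` of a list, in order. -/
def forEach {ι : Type*} (l : List ι) (p : ι → Prog F O A) : Prog F O A :=
  l.foldr (fun x q => .seq (p x) q) .skip

/-- The intermediate states are indexed by the prefix already treated, so a caller can say which
elements have been processed. -/
theorem big_forEach {ι : Type*} {l : List ι} {p : ι → Prog F O A} (g : List ι → F × S)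
    (h : ∀ l₁ x l₂, l = l₁ ++ x :: l₂ → Big d (p x) (g l₁) (g (l₁ ++ [x]))) :
    Big d (forEach l p) (g []) (g l) := by
  induction l generalizing g with
  | nil => exact .skip
  | cons x l ih =>
    refine .seq (h [] x l rfl) (ih (fun l' => g (x :: l')) ?_)
    rintro l₁ y l₂ rfl
    exact h (x :: l₁) y l₂ rfl

/-! ### Determinism -/

/-- A program is deterministic if all its basic steps are. -/
def Det : Prog F O A → Prop
  | skip => True
  | act f => ∀ m o, (f m o).Subsingleton
  | seq p q => p.Det ∧ q.Det
  | ite _ p q => p.Det ∧ q.Det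
  | loop _ p => p.Det

theorem det_forEach {ι : Type*} {l : List ι} {p : ι → Prog F O A} (h : ∀ x, (p x).Det) :
    (forEach l p).Det := by
  induction l with
  | nil => trivial
  | cons x l ih => exact ⟨h x, ih⟩

/-- `skip` has no transition, so the two rules for `seq` never compete; only `act` could branch, and
`Det` excludes that. -/
theorem Next.unique {p : Prog F O A} {m : F} {o : O} {p₁ p₂ : Prog F O A} {m₁ m₂ : F}
    {a₁ a₂ : Option A} (hp : p.Det) (h₁ : Next p m o p₁ m₁ a₁) (h₂ : Next p m o p₂ m₂ a₂) :
    p₁ = p₂ ∧ m₁ = m₂ ∧ a₁ = a₂ := by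
  induction h₁ generalizing p₂ with
  | act h =>
    cases h₂ with
    | act h' =>
      have := hp _ _ h h'
      simp only [Prod.mk.injEq] at this
      exact ⟨rfl, this⟩
  | seqSkip =>
    cases h₂ with
    | seqSkip => exact ⟨rfl, rfl, rfl⟩
    | seq h => cases h
  | seq h ih =>
    cases h₂ with
    | seqSkip => cases h
    | seq h' =>
      obtain ⟨rfl, h⟩ := ih hp.1 h'
      exact ⟨rfl, h⟩
  | iteTrue h =>
    cases h₂ with
    | iteTrue => exact ⟨rfl, rfl, rfl⟩
    | iteFalse h' => exact absurd h h'
  | iteFalse h =>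
    cases h₂ with
    | iteTrue h' => exact absurd h' h
    | iteFalse => exact ⟨rfl, rfl, rfl⟩
  | loopTrue h =>
    cases h₂ with
    | loopTrue => exact ⟨rfl, rfl, rfl⟩
    | loopFalse h' => exact absurd h h'
  | loopFalse h =>
    cases h₂ with
    | loopTrue h' => exact absurd h' h
    | loopFalse => exact ⟨rfl, rfl, rfl⟩

/-- Besides determinism, this serves to identify the outcome of an arbitrary run of a deterministic
subprogram with the one outcome computed for it. -/
theorem Big.unique {p : Prog F O A} (hp : p.Det) {s s₁ s₂ : F × S} (h₁ : Big d p s s₁)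
    (h₂ : Big d p s s₂) : s₁ = s₂ := by
  induction h₁ generalizing s₂ with
  | skip => cases h₂; rfl
  | act h =>
    cases h₂ with
    | act h' =>
      have := hp _ _ h h'
      simp only [Prod.mk.injEq] at this
      rw [this.1, this.2]
  | seq _ _ ih ih' =>
    cases h₂ with
    | seq h h' =>
      obtain rfl := ih hp.1 h
      exact ih' hp.2 h'
  | iteTrue h _ ih =>
    cases h₂ with
    | iteTrue _ h' => exact ih hp.1 h'
    | iteFalse h' => exact absurd h h'
  | iteFalse h _ ih =>
    cases h₂ with
    | iteTrue h' => exact absurd h' h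
    | iteFalse _ h' => exact ih hp.2 h'
  | loopTrue h _ _ ih ih' =>
    cases h₂ with
    | loopTrue _ h' h'' =>
      obtain rfl := ih hp h'
      exact ih' hp h''
    | loopFalse h' => exact absurd h h'
  | loopFalse h =>
    cases h₂ with
    | loopTrue h' => exact absurd h' h
    | loopFalse => rfl

/-! ### The program points of a program -/

/-- The programs that can remain to be executed in the course of an execution. -/
def residuals : Prog F O A → Set (Prog F O A)
  | skip => {skip}
  | act f => {act f, skip}
  | seq p q => (fun p' => seq p' q) '' residuals p ∪ residuals q
  | ite t p q => {ite t p q} ∪ (residuals p ∪ residuals q)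
  | loop t p => {loop t p, skip} ∪ (fun p' => seq p' (loop t p)) '' residuals p

theorem finite_residuals (p : Prog F O A) : p.residuals.Finite := by
  induction p with
  | skip => exact Set.finite_singleton _
  | act f => exact (Set.finite_singleton _).insert _
  | seq p q ihp ihq => exact (ihp.image _).union ihq
  | ite t p q ihp ihq => exact (Set.finite_singleton _).union (ihp.union ihq)
  | loop t p ih => exact (Set.toFinite _).union (ih.image _)

theorem mem_residuals_self (p : Prog F O A) : p ∈ p.residuals := by
  cases p with
  | skip => exact rfl
  | act f => exact Or.inl rfl
  | seq p q => exact Or.inl ⟨p, mem_residuals_self p, rfl⟩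
  | ite t p q => exact Or.inl rfl
  | loop t p => exact Or.inl (Or.inl rfl)

/-- Closure under transitions: with `finite_residuals`, this makes the residual programs usable as
the control states of a machine. -/
theorem Next.mem_residuals {p₀ p p' : Prog F O A} {m m' : F} {o : O} {a : Option A}
    (h : Next p m o p' m' a) (hp : p ∈ p₀.residuals) : p' ∈ p₀.residuals := by
  induction p₀ generalizing p p' with
  | skip => cases hp; cases h
  | act f =>
    rcases hp with rfl | rfl
    · cases h; exact Or.inr rfl
    · cases h
  | seq p₀ q₀ ihp ihq =>
    rcases hp with ⟨p, hp, rfl⟩ | hp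
    · cases h with
      | seqSkip => exact Or.inr (mem_residuals_self _)
      | seq h => exact Or.inl ⟨_, ihp h hp, rfl⟩
    · exact Or.inr (ihq h hp)
  | ite t p₀ q₀ ihp ihq =>
    rcases hp with rfl | hp | hp
    · cases h with
      | iteTrue => exact Or.inr (Or.inl (mem_residuals_self _))
      | iteFalse => exact Or.inr (Or.inr (mem_residuals_self _))
    · exact Or.inr (Or.inl (ihp h hp))
    · exact Or.inr (Or.inr (ihq h hp))
  | loop t p₀ ih =>
    rcases hp with (rfl | rfl) | ⟨p, hp, rfl⟩
    · cases h with
      | loopTrue => exact Or.inr ⟨_, mem_residuals_self _, rfl⟩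
      | loopFalse => exact Or.inl (Or.inr rfl)
    · cases h
    · cases h with
      | seqSkip => exact Or.inl (Or.inl rfl)
      | seq h => exact Or.inr ⟨_, ih h hp, rfl⟩

theorem Det.residuals {p q : Prog F O A} (hp : p.Det) (hq : q ∈ p.residuals) : q.Det := by
  induction p generalizing q with
  | skip => cases hq; trivial
  | act f => rcases hq with rfl | rfl; exacts [hp, trivial]
  | seq p₁ p₂ ih₁ ih₂ =>
    rcases hq with ⟨q, hq, rfl⟩ | hq
    exacts [⟨ih₁ hp.1 hq, hp.2⟩, ih₂ hp.2 hq]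
  | ite t p₁ p₂ ih₁ ih₂ =>
    rcases hq with rfl | hq | hq
    exacts [hp, ih₁ hp.1 hq, ih₂ hp.2 hq]
  | loop t p ih =>
    rcases hq with (rfl | rfl) | ⟨q, hq, rfl⟩
    exacts [hp, trivial, ⟨ih hp hq, hp⟩]

/-! ### Safety -/

/-- All stores that occur in computations of `p` from `s` satisfy `P`. -/
def Safe (d : Device O A S) (P : S → Prop) (p : Prog F O A) (s : F × S) : Prop :=
  ∀ y, Relation.ReflTransGen (Step d) (p, s) y → P y.2.2

/-- Every basic step of the program preserves `P`. -/
def Preserves (d : Device O A S) (P : S → Prop) : Prog F O A → Prop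
  | skip => True
  | act f => ∀ m s, P s → ∀ m' a, (m', a) ∈ f m (d.obs s) → P (d.run a s)
  | seq p q => p.Preserves d P ∧ q.Preserves d P
  | ite _ p q => p.Preserves d P ∧ q.Preserves d P
  | loop _ p => p.Preserves d P

variable {P : S → Prop}

theorem Next.preserves {p p' : Prog F O A} {m m' : F} {a : Option A} {s : S}
    (h : Next p m (d.obs s) p' m' a) (hp : p.Preserves d P) (hs : P s) :
    p'.Preserves d P ∧ P (d.run a s) := by
  generalize ho : d.obs s = o at h
  induction h with
  | act h => subst ho; exact ⟨trivial, hp _ _ hs _ _ h⟩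
  | seqSkip => exact ⟨hp.2, hs⟩
  | seq _ ih => exact ⟨⟨(ih hp.1 ho).1, hp.2⟩, (ih hp.1 ho).2⟩
  | iteTrue => exact ⟨hp.1, hs⟩
  | iteFalse => exact ⟨hp.2, hs⟩
  | loopTrue => exact ⟨⟨hp, hp⟩, hs⟩
  | loopFalse => exact ⟨trivial, hs⟩

theorem Preserves.safe {p : Prog F O A} (hp : p.Preserves d P) {s : F × S} (hs : P s.2) :
    Safe d P p s := by
  intro y h
  suffices H : y.1.Preserves d P ∧ P y.2.2 from H.2
  induction h with
  | refl => exact ⟨hp, hs⟩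
  | tail _ h ih =>
    obtain ⟨a, h, h'⟩ := h
    rw [h']
    exact h.preserves ih.1 ih.2

/-- A computation of a sequence is either still inside its first part or has completed it, in which
case the first part has a big-step outcome. -/
theorem reach_seq_cases {p q : Prog F O A} {s : F × S} {y : Prog F O A × F × S}
    (h : Relation.ReflTransGen (Step d) (seq p q, s) y) :
    (∃ p', y.1 = seq p' q ∧ Relation.ReflTransGen (Step d) (p, s) (p', y.2)) ∨
      ∃ s', Big d p s s' ∧ Relation.ReflTransGen (Step d) (q, s') y := by
  induction h with
  | refl => exact Or.inl ⟨p, rfl, .refl⟩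
  | tail _ h ih =>
    rename_i y z _
    obtain ⟨py, my, sy⟩ := y
    obtain ⟨pz, mz, sz⟩ := z
    rcases ih with ⟨p', h₁, h₂⟩ | ⟨s', h₁, h₂⟩
    · obtain ⟨a, hn, ha⟩ := h
      dsimp only at *
      subst h₁ ha
      cases hn with
      | seqSkip => exact Or.inr ⟨_, reach_skip_iff.1 h₂, .refl⟩
      | seq hn => exact Or.inl ⟨_, rfl, h₂.tail ⟨_, hn, rfl⟩⟩
    · exact Or.inr ⟨s', h₁, h₂.tail h⟩

theorem Safe.seq {p q : Prog F O A} {s : F × S} (hp : Safe d P p s)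
    (hq : ∀ s', Big d p s s' → Safe d P q s') : Safe d P (.seq p q) s := by
  intro y h
  rcases reach_seq_cases h with ⟨p', _, h⟩ | ⟨s', h₁, h₂⟩
  · exact hp (p', y.2) h
  · exact hq s' h₁ _ h₂

theorem Safe.act {f : F → O → Set (F × Option A)} {s : F × S} (hs : P s.2)
    (h : ∀ s', Big d (.act f) s s' → P s'.2) : Safe d P (.act f) s := by
  intro y hy
  rcases Relation.ReflTransGen.cases_head hy with rfl | ⟨z, ⟨a, hn, ha⟩, hz⟩
  · exact hs
  · obtain ⟨pz, rz⟩ := z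
    dsimp only at hn ha
    cases hn with
    | act hn =>
      have hz' : y = (Prog.skip, rz) := by
        rcases Relation.ReflTransGen.cases_head hz with rfl | ⟨_, ⟨a, hn, _⟩, _⟩
        · rfl
        · cases hn
      rw [hz']
      exact h rz (big_act.2 ⟨_, hn, ha⟩)

theorem Safe.ite {t : F → O → Prop} {p q : Prog F O A} {s : F × S} (hs : P s.2)
    (hp : t s.1 (d.obs s.2) → Safe d P p s) (hq : ¬ t s.1 (d.obs s.2) → Safe d P q s) :
    Safe d P (.ite t p q) s := by
  intro y hy
  rcases Relation.ReflTransGen.cases_head hy with rfl | ⟨⟨pz, rz⟩, ⟨a, hn, ha⟩, hz⟩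
  · exact hs
  · dsimp only at hn ha
    obtain ⟨m, s⟩ := s
    obtain ⟨mz, sz⟩ := rz
    dsimp only at hn ha
    subst ha
    cases hn with
    | iteTrue h => exact hp h y hz
    | iteFalse h => exact hq h y hz

theorem Safe.loop {t : F → O → Prop} {p : Prog F O A} (I : F × S → Prop) (hI : ∀ s, I s → P s.2)
    (hp : ∀ s, I s → t s.1 (d.obs s.2) → Safe d P p s ∧ ∀ s', Big d p s s' → I s') {s : F × S}
    (hs : I s) : Safe d P (.loop t p) s := by
  intro y h
  -- Three phases of a loop: before a test, after the exit, or inside an iteration that began in a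
  -- state satisfying the invariant.
  suffices H : (∃ r, I r ∧ y = (Prog.loop t p, r)) ∨ (∃ r, I r ∧ y = (Prog.skip, r)) ∨
      ∃ r p', I r ∧ t r.1 (d.obs r.2) ∧ y.1 = Prog.seq p' (.loop t p) ∧
        Relation.ReflTransGen (Step d) (p, r) (p', y.2) by
    rcases H with ⟨r, hr, rfl⟩ | ⟨r, hr, rfl⟩ | ⟨r, p', hr, ht, _, h⟩
    · exact hI r hr
    · exact hI r hr
    · exact (hp r hr ht).1 (p', y.2) h
  induction h with
  | refl => exact Or.inl ⟨s, hs, rfl⟩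
  | tail _ h ih =>
    rename_i y z _
    obtain ⟨pz, mz, sz⟩ := z
    obtain ⟨a, hn, ha⟩ := h
    rcases ih with ⟨r, hr, rfl⟩ | ⟨r, hr, rfl⟩ | ⟨r, p', hr, ht, hy, h⟩
    · dsimp only at hn ha
      subst ha
      cases hn with
      | loopTrue ht => exact Or.inr (Or.inr ⟨r, _, hr, ht, rfl, .refl⟩)
      | loopFalse => exact Or.inr (Or.inl ⟨r, hr, rfl⟩)
    · cases hn
    · obtain ⟨py, my, sy⟩ := y
      dsimp only at hy hn ha
      subst hy ha
      cases hn with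
      | seqSkip => exact Or.inl ⟨_, (hp r hr ht).2 _ (reach_skip_iff.1 h), rfl⟩
      | seq hn => exact Or.inr (Or.inr ⟨r, _, hr, ht, rfl, h.tail ⟨_, hn, rfl⟩⟩)

/-! ### Simulation of a transition system by a loop -/

/-- The loop test asks for a nonaccepting state, so iterations follow a path of `step` and the loop
is left exactly on acceptance. The relation `R` is the bisimulation between configurations and
program states. -/
theorem exists_big_loop_iff {X : Type*} {step : X → X → Prop} {acc : X → Prop}
    (R : X → F × S → Prop) {t : F → O → Prop} {p : Prog F O A}
    (ht : ∀ x s, R x s → (t s.1 (d.obs s.2) ↔ ¬ acc x))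
    (sound : ∀ x s s', R x s → Big d p s s' → ∃ x', step x x' ∧ R x' s')
    (complete : ∀ x s x', R x s → step x x' → ∃ s', Big d p s s' ∧ R x' s')
    {x : X} {s : F × S} (hx : R x s) :
    (∃ s', Big d (.loop t p) s s') ↔ ∃ x', Relation.ReflTransGen step x x' ∧ acc x' := by
  constructor
  · rintro ⟨s', h⟩
    generalize hq : Prog.loop t p = q at h
    induction h generalizing x with
    | loopTrue h h' _ _ ih =>
      cases hq
      obtain ⟨x', hs, hx'⟩ := sound x _ _ hx h'
      obtain ⟨x'', h₁, h₂⟩ := ih hx' rfl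
      exact ⟨x'', .head hs h₁, h₂⟩
    | loopFalse h =>
      cases hq
      exact ⟨x, .refl, not_not.1 fun h' => h ((ht x _ hx).2 h')⟩
    | _ => cases hq
  · rintro ⟨x', h, hacc⟩
    induction h using Relation.ReflTransGen.head_induction_on generalizing s with
    | refl => exact ⟨s, .loopFalse fun h => (ht _ _ hx).1 h hacc⟩
    | head h _ ih =>
      obtain ⟨r, hb, hr⟩ := complete _ _ _ hx h
      -- An earlier configuration of the given path may already accept; then the loop stops there.
      by_cases h' : t s.1 (d.obs s.2)
      · obtain ⟨s', hs'⟩ := ih hr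
        exact ⟨s', .loopTrue h' hb hs'⟩
      · exact ⟨s, .loopFalse h'⟩

end Prog

/-! ### From programs to machines -/

namespace Prog

/-- The program points of `p`, as a small type. -/
def Point {F O A : Type*} (p : Prog F O A) : Type :=
  have := p.finite_residuals.to_subtype
  Shrink.{0} p.residuals

namespace Point

variable {F O A S : Type*} {p : Prog F O A}

/-- The program that remains to be executed at a program point. -/
noncomputable def prog (x : p.Point) : Prog F O A :=
  have := p.finite_residuals.to_subtype
  ((equivShrink.{0} p.residuals).symm x).1

theorem prog_mem (x : p.Point) : x.prog ∈ p.residuals :=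
  have := p.finite_residuals.to_subtype
  ((equivShrink.{0} p.residuals).symm x).2

theorem prog_injective : Function.Injective (prog : p.Point → Prog F O A) :=
  have := p.finite_residuals.to_subtype
  Subtype.val_injective.comp (equivShrink.{0} p.residuals).symm.injective

theorem exists_prog_eq {p' : Prog F O A} (h : p' ∈ p.residuals) : ∃ x : p.Point, x.prog = p' := by
  have := p.finite_residuals.to_subtype
  exact ⟨equivShrink.{0} p.residuals ⟨p', h⟩, by simp [prog]⟩

instance : Finite p.Point :=
  have := p.finite_residuals.to_subtype
  Finite.of_equiv _ (equivShrink.{0} p.residuals)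

/-- The program point at the start of the program. -/
noncomputable def start (p : Prog F O A) : p.Point :=
  (exists_prog_eq p.mem_residuals_self).choose

@[simp]
theorem prog_start (p : Prog F O A) : (start p).prog = p :=
  (exists_prog_eq p.mem_residuals_self).choose_spec

end Point

section Simulation

variable {F O A S X : Type*} {d : Device O A S} {step : X → X → Prop}
  {view : X → Prog F O A × F × S}

theorem reach_view
    (sound : ∀ x y, step x y → view x = view y ∨ Step d (view x) (view y)) {x y : X}
    (h : Relation.ReflTransGen step x y) :
    Relation.ReflTransGen (Step d) (view x) (view y) := by
  induction h with
  | refl => exact .refl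
  | tail _ h ih =>
    rcases sound _ _ h with h | h
    · rwa [← h]
    · exact ih.tail h

/-- Machine steps that leave `view` unchanged are allowed, to make room for the idle steps of a
pebble automaton whose program is stuck. -/
theorem exists_reach_skip_iff
    (sound : ∀ x y, step x y → view x = view y ∨ Step d (view x) (view y))
    (complete : ∀ x z, Step d (view x) z → ∃ y, view y = z ∧ step x y)
    {p : Prog F O A} {x : X} (hx : (view x).1 = p) :
    (∃ y, Relation.ReflTransGen step x y ∧ (view y).1 = skip) ↔
      ∃ s', Big d p (view x).2 s' := by
  subst hx
  constructor
  · rintro ⟨y, h, hy⟩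
    refine ⟨(view y).2, reach_skip_iff.1 ?_⟩
    rw [← hy]
    exact reach_view sound h
  · rintro ⟨s', h⟩
    have h := h.reach
    suffices H : ∀ z, Relation.ReflTransGen (Step d) (view x) z →
        ∃ y, view y = z ∧ Relation.ReflTransGen step x y by
      obtain ⟨y, hy, h⟩ := H _ h
      exact ⟨y, h, by rw [hy]⟩
    intro z h
    induction h with
    | refl => exact ⟨x, rfl, .refl⟩
    | tail _ h ih =>
      obtain ⟨y, rfl, hy⟩ := ih
      obtain ⟨y', hy', h⟩ := complete _ _ h
      exact ⟨y', hy', hy.tail h⟩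

end Simulation

end Prog

/-! ### Pebble automata as machines that execute programs -/

/-- The store of a `k`-pebble automaton: the positions of its head and its pebbles. -/
structure PebbleStore (α : Type*) (k : ℕ) (w : List α) where
  head : Cell w
  pebble : Fin k → Option (Cell w)

/-- What a `k`-pebble automaton sees: the scanned symbol, the pebbles on the scanned cell and the
available pebbles. -/
abbrev PebbleObs (α : Type*) (k : ℕ) := Symbol α × Finset (Fin k) × Finset (Fin k)

/-- The action `(P, ε)` distributes the available pebbles and those on the scanned cell: those in
`P` are put on the scanned cell, the others are made available. Then the head moves by `ε`. -/
abbrev PebbleAct (k : ℕ) := Finset (Fin k) × Move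

/-- The device underlying `k`-pebble automata. -/
def pebbleDevice {α : Type*} (k : ℕ) (w : List α) :
    Device (PebbleObs α k) (PebbleAct k) (PebbleStore α k w) where
  obs s := (scan w s.head, Finset.univ.filter fun i => s.pebble i = some s.head,
    Finset.univ.filter fun i => s.pebble i = none)
  act a s :=
    { head := Move.onInput a.2 s.head
      pebble := fun i => if s.pebble i = some s.head ∨ s.pebble i = none then
        (if i ∈ a.1 then some s.head else none) else s.pebble i }

namespace Prog

/-- The values of the transition function of a pebble automaton that correspond to an action. -/
def pebbleOutput {k : ℕ} (B C : Finset (Fin k)) :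
    Option (PebbleAct k) → Finset (Fin k) × Finset (Fin k) × Move
  | none => (B, C, Move.stay)
  | some a => ((B ∪ C) ∩ a.1, (B ∪ C) \ a.1, a.2)

theorem pebbleOutput_preserved {k : ℕ} {B C : Finset (Fin k)} (h : Disjoint B C)
    (a : Option (PebbleAct k)) :
    (pebbleOutput B C a).1 ∪ (pebbleOutput B C a).2.1 = B ∪ C ∧
      Disjoint (pebbleOutput B C a).1 (pebbleOutput B C a).2.1 := by
  cases a with
  | none => exact ⟨rfl, h⟩
  | some a =>
    refine ⟨?_, ?_⟩
    · ext i
      simp only [pebbleOutput, Finset.mem_union, Finset.mem_inter, Finset.mem_sdiff]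
      tauto
    · rw [Finset.disjoint_left]
      intro i
      simp only [pebbleOutput, Finset.mem_union, Finset.mem_inter, Finset.mem_sdiff]
      tauto

/-- The pebble automaton that executes `p` with initial memory `m₀`. It accepts when the program
terminates; where the program cannot go on, it loops. -/
noncomputable def toPebble {α : Type*} {k : ℕ} {F : Type} [Finite F]
    (p : Prog F (PebbleObs α k) (PebbleAct k)) (m₀ : F) : PebbleAutomaton α k where
  Q := p.Point × F
  finite_Q := inferInstance
  start := (Point.start p, m₀)
  accept := {x | x.1.prog = skip}
  δ x a B C := {r | (∃ y, Next x.1.prog x.2 (a, B, C) r.1.1.prog r.1.2 y ∧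
      r.2 = pebbleOutput B C y) ∨
    ((∀ p' m' y, ¬ Next x.1.prog x.2 (a, B, C) p' m' y) ∧ r = (x, B, C, Move.stay))}
  pebbles_preserved := by
    rintro x a B C h p D K ε (⟨y, -, hy⟩ | ⟨-, hy⟩)
    · have := pebbleOutput_preserved h y
      rw [← hy] at this
      exact this
    · cases hy
      exact ⟨rfl, h⟩

variable {α : Type*} {k : ℕ} {F : Type} [Finite F]
  {p : Prog F (PebbleObs α k) (PebbleAct k)} {m₀ : F}

/-- A deterministic pebble automaton must have exactly one transition everywhere. Uniqueness comes
from `Next.unique`, existence from the idle transition in stuck situations. -/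
theorem toPebble_isDeterministic (hp : p.Det) : (p.toPebble m₀).IsDeterministic := by
  intro x a B C
  by_cases h : ∃ p' m' y, Next x.1.prog x.2 (a, B, C) p' m' y
  · obtain ⟨p', m', y, h⟩ := h
    obtain ⟨x', rfl⟩ := Point.exists_prog_eq (h.mem_residuals x.1.prog_mem)
    refine ⟨((x', m'), pebbleOutput B C y), Or.inl ⟨y, h, rfl⟩, ?_⟩
    rintro ⟨⟨x'', m''⟩, r⟩ (⟨y', h', hr⟩ | ⟨h', -⟩)
    · obtain ⟨h₁, h₂, h₃⟩ := Next.unique (hp.residuals x.1.prog_mem) h' h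
      dsimp only at h₁ h₂ h₃ hr
      rw [Point.prog_injective h₁, h₂, hr, h₃]
    · exact absurd h (h' _ _ _)
  · push Not at h
    refine ⟨(x, B, C, Move.stay), Or.inr ⟨h, rfl⟩, ?_⟩
    rintro r (⟨y, h', -⟩ | ⟨-, h'⟩)
    · exact absurd h' (h _ _ _)
    · exact h'

theorem mem_language_toPebble {w : List α} : w ∈ (p.toPebble m₀).language ↔
    ∃ s', Big (pebbleDevice k w) p (m₀, ⟨0, fun _ => none⟩) s' := by
  let view (c : (p.toPebble m₀).Cfg w) : Prog F (PebbleObs α k) (PebbleAct k) × F ×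
    PebbleStore α k w := (c.state.1.prog, c.state.2, ⟨c.head, c.pebble⟩)
  -- The sets written by `pebbleOutput` have the same effect on the pebbles as the device action,
  -- including `none`, where the pebbles are put back as they were.
  have run_eq (c c' : (p.toPebble m₀).Cfg w) (y : Option (PebbleAct k)) :
      (c'.head = Move.onInput (pebbleOutput c.here c.available y).2.2 c.head ∧
        ∀ i, c'.pebble i = if i ∈ (pebbleOutput c.here c.available y).1 then some c.head
          else if i ∈ (pebbleOutput c.here c.available y).2.1 then none else c.pebble i) ↔
      (⟨c'.head, c'.pebble⟩ : PebbleStore α k w) =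
        (pebbleDevice k w).run y ⟨c.head, c.pebble⟩ := by
    cases y with
    | none =>
      simp only [pebbleOutput, Device.run, PebbleStore.mk.injEq, Move.onInput, funext_iff,
        PebbleAutomaton.Cfg.here, PebbleAutomaton.Cfg.available, Finset.mem_filter,
        Finset.mem_univ, true_and]
      refine and_congr Iff.rfl (forall_congr' fun i => ?_)
      split_ifs with h₁ h₂ <;> simp_all
    | some a =>
      simp only [pebbleOutput, Device.run, PebbleStore.mk.injEq, funext_iff, pebbleDevice,
        PebbleAutomaton.Cfg.here, PebbleAutomaton.Cfg.available, Finset.mem_filter,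
        Finset.mem_univ, true_and, Finset.mem_inter, Finset.mem_union, Finset.mem_sdiff]
      refine and_congr Iff.rfl (forall_congr' fun i => ?_)
      split_ifs <;> simp_all
  refine (exists_reach_skip_iff (d := pebbleDevice k w) (view := view) ?_ ?_
    (p := p) (x := (p.toPebble m₀).init w) (Point.prog_start p))
  · rintro c c' ⟨q, D, K, ε, h, rfl, h₁, h₂⟩
    rcases h with ⟨y, hn, hy⟩ | ⟨-, hy⟩
    · right
      refine ⟨y, hn, (run_eq c c' y).1 ?_⟩
      dsimp only at hy
      rw [← hy]
      exact ⟨h₁, h₂⟩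
    -- The idle transition changes nothing, hence the view is the same before and after.
    · left
      obtain ⟨hq, hD, hK, hε⟩ : c'.state = c.state ∧ D = c.here ∧ K = c.available ∧
          ε = Move.stay := ⟨congrArg (·.1) hy, congrArg (·.2.1) hy, congrArg (·.2.2.1) hy,
            congrArg (·.2.2.2) hy⟩
      subst hD hK hε
      have := (run_eq c c' none).1 ⟨h₁, h₂⟩
      simp only [Device.run, PebbleStore.mk.injEq] at this
      simp only [view, hq, this]
  · rintro c ⟨p', m', s'⟩ ⟨y, hn, hy⟩
    obtain ⟨x', rfl⟩ := Point.exists_prog_eq (hn.mem_residuals c.state.1.prog_mem)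
    dsimp only at hn hy
    refine ⟨⟨(x', m'), s'.head, s'.pebble⟩, rfl, ?_⟩
    have := (run_eq c ⟨(x', m'), s'.head, s'.pebble⟩ y).2 hy
    exact ⟨(x', m'), _, _, _, Or.inl ⟨y, hn, rfl⟩, rfl, this.1, this.2⟩

end Prog

/-! ### One-tape Turing machines as machines that execute programs -/

/-- The store of a Turing machine with one work tape. -/
@[ext]
structure TapeStore (α Γ : Type*) (w : List α) where
  head : Cell w
  pos : ℕ
  tape : ℕ → Γ

/-- The device underlying Turing machines with one work tape. The action `(g, ε, η)` writes `g`,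
moves the input head by `ε` and the work head by `η`. -/
def tapeDevice {α : Type*} (Γ : Type) (w : List α) :
    Device (Symbol α × Γ) (Γ × Move × Move) (TapeStore α Γ w) where
  obs s := (scan w s.head, s.tape s.pos)
  act a s :=
    { head := Move.onInput a.2.1 s.head
      pos := Move.onWork a.2.2 s.pos
      tape := Function.update s.tape s.pos a.1 }

namespace Prog

variable {α : Type*} {Γ F : Type} [Finite Γ] [Finite F]

/-- The action of a Turing machine that corresponds to an optional action. -/
def tapeOutput (g : Γ) : Option (Γ × Move × Move) → Γ × Move × Move
  | none => (g, Move.stay, Move.stay)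
  | some a => a

/-- The Turing machine that executes `p` with initial memory `m₀`. It accepts when the program
terminates. -/
noncomputable def toTuring (p : Prog F (Symbol α × Γ) (Γ × Move × Move)) (blank : Γ) (m₀ : F) :
    TuringMachine α 1 where
  Q := p.Point × F
  finite_Q := inferInstance
  Γ := Γ
  finite_Γ := inferInstance
  blank := blank
  start := (Point.start p, m₀)
  accept := {x | x.1.prog = skip}
  δ x a f := {r | ∃ y, Next x.1.prog x.2 (a, f 0) r.1.1.prog r.1.2 y ∧
    r.2 = (fun _ => (tapeOutput (f 0) y).1, (tapeOutput (f 0) y).2.1,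
      fun _ => (tapeOutput (f 0) y).2.2)}

variable {p : Prog F (Symbol α × Γ) (Γ × Move × Move)} {blank : Γ} {m₀ : F}

theorem toTuring_isDeterministic (hp : p.Det) : (p.toTuring blank m₀).IsDeterministic := by
  rintro x a f ⟨⟨q₁, m₁⟩, r₁⟩ ⟨y₁, h₁, e₁⟩ ⟨⟨q₂, m₂⟩, r₂⟩ ⟨y₂, h₂, e₂⟩
  obtain ⟨hq, hm, hy⟩ := Next.unique (hp.residuals x.1.prog_mem) h₁ h₂
  dsimp only at hq hm e₁ e₂
  rw [Point.prog_injective hq, hm, e₁, e₂, hy]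

/-- The part of a configuration of `p.toTuring blank m₀` that matters for the program. -/
noncomputable def turingView {w : List α} (c : (p.toTuring blank m₀).Cfg w) :
    Prog F (Symbol α × Γ) (Γ × Move × Move) × F × TapeStore α Γ w :=
  (c.state.1.prog, c.state.2, ⟨c.head, c.workHead 0, c.tape 0⟩)

theorem turing_run_eq {w : List α} (c c' : (p.toTuring blank m₀).Cfg w)
    (y : Option (Γ × Move × Move)) :
    (c'.head = Move.onInput (tapeOutput (c.tape 0 (c.workHead 0)) y).2.1 c.head ∧
      (∀ j, c'.workHead j =
        Move.onWork (tapeOutput (c.tape 0 (c.workHead 0)) y).2.2 (c.workHead j)) ∧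
      ∀ j, c'.tape j = Function.update (c.tape j) (c.workHead j)
        (tapeOutput (c.tape 0 (c.workHead 0)) y).1) ↔
    (⟨c'.head, c'.workHead 0, c'.tape 0⟩ : TapeStore α Γ w) =
      (tapeDevice Γ w).run y ⟨c.head, c.workHead 0, c.tape 0⟩ := by
  cases y with
  | none =>
    simp only [tapeOutput, Device.run, Move.onInput, Move.onWork, Fin.forall_fin_one]
    rw [Function.update_eq_self]
    exact ⟨fun ⟨h, h', h''⟩ => TapeStore.ext h h' h'',
      fun h => ⟨congrArg (·.head) h, congrArg (·.pos) h, congrArg (·.tape) h⟩⟩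
  | some a =>
    simp only [tapeOutput, Device.run, tapeDevice, Fin.forall_fin_one]
    exact ⟨fun ⟨h, h', h''⟩ => TapeStore.ext h h' h'',
      fun h => ⟨congrArg (·.head) h, congrArg (·.pos) h, congrArg (·.tape) h⟩⟩

theorem turingView_sound {w : List α} (c c' : (p.toTuring blank m₀).Cfg w)
    (h : (p.toTuring blank m₀).Step w c c') :
    turingView c = turingView c' ∨ Step (tapeDevice Γ w) (turingView c) (turingView c') := by
  obtain ⟨q, g, ε, η, ⟨y, hn, hy⟩, rfl, h⟩ := h
  right
  refine ⟨y, hn, (turing_run_eq c c' y).1 ?_⟩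
  dsimp only at hy
  cases hy
  exact h

theorem turingView_complete {w : List α} (c : (p.toTuring blank m₀).Cfg w)
    (z : Prog F (Symbol α × Γ) (Γ × Move × Move) × F × TapeStore α Γ w)
    (h : Step (tapeDevice Γ w) (turingView c) z) :
    ∃ c', turingView c' = z ∧ (p.toTuring blank m₀).Step w c c' := by
  obtain ⟨p', m', s'⟩ := z
  obtain ⟨y, hn, hy⟩ := h
  obtain ⟨x', rfl⟩ := Point.exists_prog_eq (hn.mem_residuals c.state.1.prog_mem)
  refine ⟨⟨(x', m'), s'.head, fun _ => s'.pos, fun _ => s'.tape⟩, rfl, ?_⟩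
  exact ⟨(x', m'), _, _, _, ⟨y, hn, rfl⟩, rfl,
    (turing_run_eq c ⟨(x', m'), s'.head, fun _ => s'.pos, fun _ => s'.tape⟩ y).2 hy⟩

theorem mem_language_toTuring {w : List α} : w ∈ (p.toTuring blank m₀).language ↔
    ∃ s', Big (tapeDevice Γ w) p (m₀, ⟨0, 0, fun _ => blank⟩) s' :=
  exists_reach_skip_iff (d := tapeDevice Γ w) (view := turingView) turingView_sound
    turingView_complete (p := p) (x := (p.toTuring blank m₀).init w) (Point.prog_start p)

/-- Every step of the machine is a step of the program, so a safety property of the program bounds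
the work head in all computations. -/
theorem toTuring_spaceBound {b : ℕ → ℕ}
    (h : ∀ w : List α, Safe (tapeDevice Γ w) (fun s => s.pos < b w.length) p
      (m₀, ⟨0, 0, fun _ => blank⟩)) : (p.toTuring blank m₀).SpaceBound b := by
  intro w c hc j
  rw [Subsingleton.elim j 0]
  refine h w (turingView c) ?_
  have := reach_view (d := tapeDevice Γ w) turingView_sound hc
  rwa [show turingView ((p.toTuring blank m₀).init w) = (p, m₀, ⟨0, 0, fun _ => blank⟩) by
    simp [turingView, TuringMachine.init, toTuring]] at this

end Prog

theorem finite_move : Finite Move :=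
  Finite.of_surjective (fun i : Fin 3 => ![Move.left, Move.stay, Move.right] i) fun m => by
    cases m
    exacts [⟨0, rfl⟩, ⟨1, rfl⟩, ⟨2, rfl⟩]

/-! ### Simulation of a pebble automaton by a Turing machine -/

/-- One binary digit of each of several numbers: of the head position, and of the positions of `m`
pebbles. -/
abbrev Col (m : ℕ) := Option (Fin m) → Bool

section Columns

variable {m : ℕ}

/-- The number in row `x` of a list of columns, with the least significant digit first. -/
def colVal (x : Option (Fin m)) : List (Col m) → ℕ
  | [] => 0
  | c :: l => (c x).toNat + 2 * colVal x l

theorem colVal_lt (x : Option (Fin m)) (l : List (Col m)) : colVal x l < 2 ^ l.length := by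
  induction l with
  | nil => simp [colVal]
  | cons c l ih =>
    have := (c x).toNat_le
    rw [colVal, List.length_cons, pow_succ]
    omega

theorem colVal_append_singleton (x : Option (Fin m)) (l : List (Col m)) (c : Col m) :
    colVal x (l ++ [c]) = colVal x l + 2 ^ l.length * (c x).toNat := by
  induction l with
  | nil => simp [colVal]
  | cons a l ih =>
    rw [List.cons_append, colVal, ih, colVal, List.length_cons, pow_succ]
    ring

/-- Rows of equal length are compared digit by digit, so a sweep with finite memory can decide
equality of two positions. -/
theorem colVal_eq_iff (x y : Option (Fin m)) (l : List (Col m)) :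
    colVal x l = colVal y l ↔ ∀ c ∈ l, c x = c y := by
  induction l with
  | nil => simp [colVal]
  | cons c l ih =>
    rw [List.forall_mem_cons, ← ih, colVal, colVal]
    cases c x <;> cases c y <;> simp <;> omega

/-- The work tape that holds a list of columns, enclosed between blanks. -/
def colTape (l : List (Col m)) : ℕ → Option (Col m)
  | 0 => none
  | i + 1 => l[i]?

theorem colTape_append_cons (d : List (Col m)) (c : Col m) (r : List (Col m)) :
    colTape (d ++ c :: r) (d.length + 1) = some c := by
  simp [colTape]

theorem colTape_length (l : List (Col m)) : colTape l (l.length + 1) = none := by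
  simp [colTape]

theorem update_colTape (d : List (Col m)) (c c' : Col m) (r : List (Col m)) :
    Function.update (colTape (d ++ c :: r)) (d.length + 1) (some c') =
      colTape (d ++ c' :: r) := by
  funext i
  cases i with
  | zero => rfl
  | succ i =>
    rw [Function.update_apply]
    simp only [colTape, Nat.add_right_cancel_iff]
    split_ifs with h
    · simp [h]
    · simp only [List.getElem?_append, List.getElem?_cons]
      split_ifs <;> first | rfl | omega

theorem update_colTape_length (l : List (Col m)) (c : Col m) :
    Function.update (colTape l) (l.length + 1) (some c) = colTape (l ++ [c]) := by
  funext i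
  cases i with
  | zero => rfl
  | succ i =>
    rw [Function.update_apply]
    simp only [colTape, Nat.add_right_cancel_iff]
    split_ifs with h
    · simp [h]
    · simp only [List.getElem?_append, List.getElem?_cons]
      split_ifs with h₁ h₂
      · rfl
      · omega
      · simp; omega

end Columns

/-! ### Sweeping over a work tape of columns -/

namespace Prog

variable {α : Type*} {F : Type} {m : ℕ} {w : List α}

/-- Programs for a Turing machine whose work tape holds columns. -/
abbrev ColProg (α : Type*) (F : Type) (m : ℕ) :=
  Prog F (Symbol α × Option (Col m)) (Option (Col m) × Move × Move)

/-- Move the work head. -/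
def moveWork (η : Move) : ColProg α F m :=
  .act fun f o => {(f, some (o.2, Move.stay, η))}

theorem big_moveWork (η : Move) (f : F) (s : TapeStore α (Option (Col m)) w) :
    Big (tapeDevice _ w) (moveWork η) (f, s) (f, ⟨s.head, η.onWork s.pos, s.tape⟩) := by
  refine big_act.2 ⟨_, rfl, ?_⟩
  simp [Device.run, tapeDevice, Move.onInput]

/-- Replace the memory and the columns from the work head on by means of `u`, from left to right. -/
def sweep (u : F → Col m → F × Col m) : ColProg α F m :=
  .loop (fun _ o => o.2 ≠ none) (.act fun f o =>
    {r | ∃ c, o.2 = some c ∧ r = ((u f c).1, some (some (u f c).2, Move.stay, Move.right))})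

/-- The effect of `sweep`. -/
def sweepResult (u : F → Col m → F × Col m) : F → List (Col m) → F × List (Col m)
  | f, [] => (f, [])
  | f, c :: l => ((sweepResult u (u f c).1 l).1, (u f c).2 :: (sweepResult u (u f c).1 l).2)

theorem length_sweepResult (u : F → Col m → F × Col m) (f : F) (l : List (Col m)) :
    (sweepResult u f l).2.length = l.length := by
  induction l generalizing f with
  | nil => rfl
  | cons c l ih => simp [sweepResult, ih]

theorem big_sweep (u : F → Col m → F × Col m) (f : F) (h : Cell w) (d r : List (Col m)) :
    Big (tapeDevice _ w) (sweep u) (f, ⟨h, d.length + 1, colTape (d ++ r)⟩)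
      ((sweepResult u f r).1, ⟨h, (d ++ r).length + 1, colTape (d ++ (sweepResult u f r).2)⟩) := by
  induction r generalizing d f with
  | nil =>
    simp only [sweepResult, List.append_nil]
    refine .loopFalse ?_
    simp [tapeDevice, colTape_length]
  | cons c r ih =>
    refine .loopTrue (s' := ((u f c).1, ⟨h, (d ++ [(u f c).2]).length + 1,
      colTape ((d ++ [(u f c).2]) ++ r)⟩)) ?_ ?_ ?_
    · simp [tapeDevice, colTape_append_cons]
    · refine big_act.2 ⟨_, ⟨c, colTape_append_cons d c r, rfl⟩, ?_⟩
      simp [Device.run, tapeDevice, Move.onInput, Move.onWork, update_colTape]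
    · change Big _ (sweep u) _ _
      simpa [sweepResult, Nat.add_right_comm, Nat.add_assoc] using ih (u f c).1 (d ++ [(u f c).2])

/-- Move the work head back to cell `1` of a tape with columns. -/
def rewind : ColProg α F m :=
  .seq (moveWork Move.left) (.seq (.loop (fun _ o => o.2 ≠ none) (moveWork Move.left))
    (moveWork Move.right))

theorem big_rewind_loop (f : F) (h : Cell w) (l : List (Col m)) :
    Big (tapeDevice _ w) (.loop (fun _ o => o.2 ≠ none) (moveWork Move.left))
      (f, ⟨h, l.length, colTape l⟩) (f, ⟨h, 0, colTape l⟩) := by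
  have := big_loop_of_sequence (d := tapeDevice (Option (Col m)) w)
    (t := fun (_ : F) o => o.2 ≠ none) (p := moveWork Move.left) l.length
    (fun i => (f, ⟨h, l.length - i, colTape l⟩)) ?_ ?_ ?_
  · simpa using this
  · intro i hi
    obtain ⟨k, hk⟩ : ∃ k, l.length - i = k + 1 := ⟨l.length - i - 1, by omega⟩
    simp only [tapeDevice, hk, colTape, ne_eq, List.getElem?_eq_none_iff]
    omega
  · simp [tapeDevice, colTape]
  · intro i hi
    exact big_moveWork _ _ _

/-- The start is the blank just past the columns, hence the unconditional first move; the blank in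
cell `0` stops the loop, even when there are no columns. -/
theorem big_rewind (f : F) (h : Cell w) (l : List (Col m)) :
    Big (tapeDevice _ w) rewind (f, ⟨h, l.length + 1, colTape l⟩) (f, ⟨h, 1, colTape l⟩) :=
  .seq (big_moveWork _ _ _) (.seq (big_rewind_loop f h l) (big_moveWork _ _ _))

theorem det_moveWork (η : Move) : (moveWork η : ColProg α F m).Det :=
  fun _ _ => Set.subsingleton_singleton

theorem det_rewind : (rewind : ColProg α F m).Det :=
  ⟨det_moveWork _, det_moveWork _, det_moveWork _⟩

theorem det_sweep (u : F → Col m → F × Col m) : (sweep u : ColProg α F m).Det := by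
  rintro f o r ⟨c, hc, rfl⟩ s ⟨c₂, hc₂, rfl⟩
  rw [hc] at hc₂
  cases hc₂
  rfl

/-- The work head and the nonblank part of the work tape are confined to an initial segment. -/
def Confined (N : ℕ) (s : TapeStore α (Option (Col m)) w) : Prop :=
  s.pos ≤ N ∧ ∀ i, N ≤ i → s.tape i = none

theorem confined_colTape {N : ℕ} {h : Cell w} {i : ℕ} {l : List (Col m)} (hi : i ≤ N)
    (hl : l.length + 1 ≤ N) : Confined N (⟨h, i, colTape l⟩ : TapeStore α (Option (Col m)) w) := by
  refine ⟨hi, fun j hj => ?_⟩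
  cases j with
  | zero => rfl
  | succ j =>
    simp only [colTape, List.getElem?_eq_none_iff]
    omega

/-- A sweep writes and moves right only on a nonblank cell, and all of these lie below `N`. -/
theorem preserves_sweep {N : ℕ} (u : F → Col m → F × Col m) :
    (sweep u).Preserves (tapeDevice _ w) (Confined N) := by
  rintro f s ⟨h₁, h₂⟩ f' a ⟨c, hc, hr⟩
  cases hr
  have hs : s.pos < N := by
    by_contra hs
    have := h₂ s.pos (by omega)
    simp only [tapeDevice] at hc
    rw [hc] at this
    cases this
  refine ⟨hs, fun i hi => ?_⟩
  simp only [Device.run, tapeDevice]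
  rw [Function.update_of_ne (by omega)]
  exact h₂ i hi

theorem preserves_moveWork_left {N : ℕ} :
    (moveWork Move.left : ColProg α F m).Preserves (tapeDevice _ w) (Confined N) := by
  rintro f s ⟨h₁, h₂⟩ f' a h
  cases h
  refine ⟨(Nat.sub_le _ _).trans h₁, fun i hi => ?_⟩
  simp only [Device.run, tapeDevice, Function.update_eq_self]
  exact h₂ i hi

/-- The last move, to the right, need not preserve `Confined` from an arbitrary store, so the exact
position before it is used. -/
theorem safe_rewind {N : ℕ} {f : F} {h : Cell w} {l : List (Col m)} (hl : l.length + 1 ≤ N) :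
    Safe (tapeDevice _ w) (Confined N) rewind (f, ⟨h, l.length + 1, colTape l⟩) := by
  refine Safe.seq (preserves_moveWork_left.safe (confined_colTape hl hl)) fun s' hs' => ?_
  obtain rfl := hs'.unique (det_moveWork _) (big_moveWork _ _ _)
  refine Safe.seq (Preserves.safe (p := .loop _ _) preserves_moveWork_left
    (confined_colTape (by simp [Move.onWork]; omega) hl)) fun s' hs' => ?_
  obtain rfl := hs'.unique det_rewind.2.1 (big_rewind_loop f h l)
  refine Safe.act (confined_colTape (by omega) hl) fun s' hs' => ?_
  obtain rfl := hs'.unique (det_moveWork Move.right) (big_moveWork _ _ _)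
  exact confined_colTape (by simp [Move.onWork]; omega) hl

end Prog

/-! ### Comparing and updating binary positions -/

/-- The finite memory for the simulation of a pebble automaton with set of states `Q`: its state and
its set of available pebbles, the pebbles that may be on the scanned cell, those that are to be put
there, and whether the head position is to be increased or decreased by one. -/
structure HeadMem (Q : Type) (m : ℕ) where
  state : Q
  avail : Finset (Fin m)
  same : Finset (Fin m)
  drop : Finset (Fin m)
  up : Bool
  carry : Bool

instance {Q : Type} [Finite Q] {m : ℕ} : Finite (HeadMem Q m) :=
  Finite.of_injective (β := Q × Finset (Fin m) × Finset (Fin m) × Finset (Fin m) × Bool × Bool)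
    (fun x => (x.state, x.avail, x.same, x.drop, x.up, x.carry)) fun x y h => by
      cases x; cases y; simpa using h

namespace HeadMem

variable {Q : Type} {m : ℕ}

/-- Compare the digits of the positions of the pebbles with those of the head position. -/
def compare (x : HeadMem Q m) (c : Col m) : HeadMem Q m × Col m :=
  ({ x with same := x.same.filter fun i => c (some i) = c none }, c)

/-- Copy a digit of the head position to the pebbles that are put down, and change it according to
the carry. -/
def advance (x : HeadMem Q m) (c : Col m) : HeadMem Q m × Col m :=
  ({ x with carry := x.carry && (if x.up then c none else !c none) },
    fun y => match y with
      | none => c none ^^ x.carry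
      | some i => if i ∈ x.drop then c none else c (some i))

/-- The effect of `compare` on the memory. -/
def compared (x : HeadMem Q m) (l : List (Col m)) : HeadMem Q m :=
  { x with same := x.same.filter fun i => colVal (some i) l = colVal none l }

theorem sweepResult_compare (x : HeadMem Q m) (l : List (Col m)) :
    Prog.sweepResult compare x l = (x.compared l, l) := by
  simp only [compared, colVal_eq_iff]
  induction l generalizing x with
  | nil => simp [Prog.sweepResult]
  | cons c l ih =>
    simp only [Prog.sweepResult, compare] at ih ⊢
    rw [ih]
    simp [Finset.filter_filter]

/-- Binary addition or subtraction of the incoming carry, with `b` the carry or borrow out of the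
last digit. Both operations flip a digit exactly when a carry arrives and differ only in when it
propagates. Pebbles receive the old digits of the head. -/
theorem sweepResult_advance (x : HeadMem Q m) (l : List (Col m)) :
    ∃ b l', Prog.sweepResult advance x l = ({ x with carry := b }, l') ∧
      (∀ i, colVal (some i) l' = if i ∈ x.drop then colVal none l else colVal (some i) l) ∧
      (x.up = true → colVal none l' + 2 ^ l.length * b.toNat = colVal none l + x.carry.toNat) ∧
      (x.up = false →
        colVal none l' + x.carry.toNat = colVal none l + 2 ^ l.length * b.toNat) := by
  induction l generalizing x with
  | nil =>
    refine ⟨x.carry, [], rfl, fun i => ?_, fun _ => ?_, fun _ => ?_⟩ <;> simp [colVal]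
  | cons c l ih =>
    obtain ⟨b, l', h, h₁, h₂, h₃⟩ := ih (advance x c).1
    refine ⟨b, (advance x c).2 :: l', ?_, fun i => ?_, fun hu => ?_, fun hu => ?_⟩
    · rw [Prog.sweepResult, h]
      rfl
    · rw [colVal, h₁]
      by_cases hi : i ∈ x.drop <;> simp [advance, colVal, hi]
    · have := h₂ hu
      simp only [advance, hu, if_true] at this
      simp only [colVal, advance, List.length_cons, pow_succ, mul_right_comm _ 2]
      -- The outgoing term becomes an atom, so that only linear arithmetic remains.
      generalize 2 ^ l.length * b.toNat = z at *
      cases hc : c none <;> cases hx : x.carry <;> simp [hc, hx] at this ⊢ <;> omega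
    · have := h₃ hu
      simp only [advance, hu] at this
      simp only [colVal, advance, List.length_cons, pow_succ, mul_right_comm _ 2]
      generalize 2 ^ l.length * b.toNat = z at *
      cases hc : c none <;> cases hx : x.carry <;> simp [hc, hx] at this ⊢ <;> omega

end HeadMem

/-- Whether a direction is the right one. -/
def Move.isRight : Move → Bool
  | Move.right => true
  | _ => false

/-- Whether the head leaves a cell with symbol `a` when it moves in direction `ε`. -/
def Move.leaves {α : Type*} : Move → Symbol α → Bool
  | Move.left, Symbol.leftEnd => false
  | Move.right, Symbol.rightEnd => false
  | Move.stay, _ => false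
  | _, _ => true

theorem scan_eq_leftEnd_iff {α : Type*} {w : List α} {i : Cell w} :
    scan w i = Symbol.leftEnd ↔ i.val = 0 := by
  unfold scan
  split_ifs with h
  · simp [h]
  · simp only [h, iff_false]
    split <;> simp

theorem scan_eq_rightEnd_iff {α : Type*} {w : List α} {i : Cell w} :
    scan w i = Symbol.rightEnd ↔ i.val = w.length + 1 := by
  unfold scan
  split_ifs with h
  · simp [h]
  · have := i.isLt
    split
    · rename_i a ha
      have := (List.getElem?_eq_some_iff.1 ha).1
      simp only [reduceCtorEq, false_iff]
      omega
    · rename_i ha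
      have := List.getElem?_eq_none_iff.1 ha
      simp only [true_iff]
      omega

/-- The endmarkers are visible, so the scanned symbol tells in advance whether a move changes the
head position; this yields the initial carry. -/
theorem onInput_val {α : Type*} {w : List α} (ε : Move) (i : Cell w) :
    (ε.onInput i).val = if ε.leaves (scan w i) then
      (if ε.isRight then i.val + 1 else i.val - 1) else i.val := by
  have := i.isLt
  cases ε with
  | stay => simp [Move.onInput, Move.leaves]
  | left =>
    simp only [Move.onInput, Move.leaves, Move.isRight]
    cases h : scan w i with
    | leftEnd =>
      have := scan_eq_leftEnd_iff.1 h
      simp [this]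
    | letter a => simp
    | rightEnd => simp
  | right =>
    simp only [Move.onInput, Move.leaves, Move.isRight]
    have h' := scan_eq_rightEnd_iff (w := w) (i := i)
    cases h : scan w i with
    | rightEnd =>
      have := h'.1 h
      simp [this]
    | _ =>
      have : i.val ≠ w.length + 1 := by simpa [h] using h'
      simp
      omega

theorem pos_of_leaves_left {α : Type*} {w : List α} {i : Cell w}
    (h : Move.left.leaves (scan w i) = true) : 0 < i.val := by
  by_contra h'
  have : scan w i = Symbol.leftEnd := scan_eq_leftEnd_iff.2 (by omega)
  simp [this, Move.leaves] at h

/-! ### The Turing machine that simulates a pebble automaton -/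

namespace PebbleAutomaton

open Prog HeadMem

variable {α : Type*} {m : ℕ} (M : PebbleAutomaton α m)

/-- Determine which pebbles have the same position as the head. -/
def comparePebbles : ColProg α (HeadMem M.Q m) m :=
  .seq (.act fun f _ => {({ f with same := Finset.univ }, none)}) (.seq (sweep compare) rewind)

/-- Perform the part of a transition that does not involve the work tape. -/
def chooseTransition : ColProg α (HeadMem M.Q m) m :=
  .act fun f o => {r | ∃ p D K ε, (p, D, K, ε) ∈ M.δ f.state o.1 (f.same \ f.avail) f.avail ∧
    r = (⟨p, K, f.same, D, ε.isRight, ε.leaves o.1⟩,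
      some (o.2, ε, Move.stay))}

/-- Append a column for the carry. -/
def appendCarry : ColProg α (HeadMem M.Q m) m :=
  .ite (fun f _ => f.up = true ∧ f.carry = true)
    (.act fun f _ => {(f, some (some Option.isNone, Move.stay, Move.right))}) .skip

/-- Update the positions of the head and of the pebbles that are put down. -/
def updatePositions : ColProg α (HeadMem M.Q m) m :=
  .seq (sweep advance) (.seq M.appendCarry rewind)

/-- The simulation of one step. -/
def simulateStep : ColProg α (HeadMem M.Q m) m :=
  .seq M.comparePebbles (.seq M.chooseTransition M.updatePositions)

/-- The simulation of a pebble automaton. -/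
def simulation : ColProg α (HeadMem M.Q m) m :=
  .seq (moveWork Move.right) (.loop (fun f _ => f.state ∉ M.accept) M.simulateStep)

theorem det_comparePebbles : M.comparePebbles.Det :=
  ⟨fun _ _ => Set.subsingleton_singleton, det_sweep _, det_rewind⟩

theorem det_appendCarry : M.appendCarry.Det :=
  ⟨fun _ _ => Set.subsingleton_singleton, trivial⟩

theorem det_updatePositions : M.updatePositions.Det :=
  ⟨det_sweep _, M.det_appendCarry, det_rewind⟩

theorem det_simulation (hM : M.IsDeterministic) : M.simulation.Det := by
  refine ⟨det_moveWork _, M.det_comparePebbles, ?_, M.det_updatePositions⟩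
  rintro f o r ⟨p, D, K, ε, h, rfl⟩ r' ⟨p', D', K', ε', h', rfl⟩
  cases (hM _ _ _ _).unique h h'
  rfl

variable {M} {w : List α}

theorem big_comparePebbles (f : HeadMem M.Q m) (h : Cell w) (l : List (Col m)) :
    Big (tapeDevice _ w) M.comparePebbles (f, ⟨h, 1, colTape l⟩)
      (({ f with same := Finset.univ } : HeadMem M.Q m).compared l, ⟨h, 1, colTape l⟩) := by
  have h₁ := big_sweep compare { f with same := Finset.univ } h [] l
  rw [sweepResult_compare] at h₁
  have h₀ : Big (tapeDevice _ w) (.act fun f _ => {({ f with same := Finset.univ }, none)})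
      (f, ⟨h, 1, colTape l⟩) ({ f with same := Finset.univ }, ⟨h, 1, colTape l⟩) :=
    big_act.2 ⟨none, rfl, rfl⟩
  exact .seq h₀ (.seq h₁ (big_rewind _ h l))

theorem safe_comparePebbles {N : ℕ} (f : HeadMem M.Q m) (h : Cell w) {l : List (Col m)}
    (hl : l.length + 1 ≤ N) :
    Safe (tapeDevice _ w) (Confined N) M.comparePebbles (f, ⟨h, 1, colTape l⟩) := by
  have hc : Confined N (⟨h, 1, colTape l⟩ : TapeStore α (Option (Col m)) w) :=
    confined_colTape (by omega) hl
  refine Safe.seq (Preserves.safe ?_ hc) fun s' hs' => ?_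
  · intro f s hs f' a ha
    cases ha
    exact hs
  · obtain ⟨a, ha, hs⟩ := big_act.1 hs'
    obtain ⟨f', s'⟩ := s'
    cases ha
    subst hs
    refine Safe.seq ((preserves_sweep _).safe hc) fun s' hs' => ?_
    have h₁ := big_sweep compare { f with same := Finset.univ } h [] l
    rw [sweepResult_compare] at h₁
    obtain rfl := hs'.unique (det_sweep _) h₁
    exact safe_rewind hl

/-- The new head position is stored without overflow, using one more column if necessary. The
invariant `2 ^ l.length ≤ 2 * (w.length + 1)` survives because a new column means that the position
`h'` is at least `2 ^ l.length`, and `h' ≤ w.length + 1`. The leftover carry in the memory is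
harmless: the next transition overwrites it. -/
theorem exists_big_updatePositions (f : HeadMem M.Q m) (h h' : Cell w) (l : List (Col m))
    (hv : h'.val = if f.carry then (if f.up then colVal none l + 1 else colVal none l - 1)
      else colVal none l)
    (hpos : f.carry = true → f.up = false → 0 < colVal none l)
    (hl : 2 ^ l.length ≤ 2 * (w.length + 1)) :
    ∃ b l', Big (tapeDevice _ w) M.updatePositions (f, ⟨h, 1, colTape l⟩)
        ({ f with carry := b }, ⟨h, 1, colTape l'⟩) ∧
      colVal none l' = h'.val ∧
      (∀ i, colVal (some i) l' = if i ∈ f.drop then colVal none l else colVal (some i) l) ∧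
      2 ^ l'.length ≤ 2 * (w.length + 1) ∧
      Safe (tapeDevice _ w) (Confined (Nat.log 2 (2 * (w.length + 1)) + 1)) M.updatePositions
        (f, ⟨h, 1, colTape l⟩) := by
  obtain ⟨b, l₁, hr, h₁, h₂, h₃⟩ := sweepResult_advance f l
  have hlen : l₁.length = l.length := by
    have := length_sweepResult advance f l
    rwa [hr] at this
  have hsw := big_sweep (w := w) advance f h [] l
  rw [hr] at hsw
  simp only [List.nil_append, List.length_nil, Nat.zero_add, ← hlen] at hsw
  have hh := h'.isLt
  have hlt := colVal_lt none l₁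
  rw [hlen] at hlt
  have hlog : ∀ {k : ℕ}, 2 ^ k ≤ 2 * (w.length + 1) →
      k + 1 ≤ Nat.log 2 (2 * (w.length + 1)) + 1 := fun hk =>
    Nat.succ_le_succ (Nat.le_log_of_pow_le one_lt_two hk)
  have hsafe : Safe (tapeDevice _ w) (Confined (Nat.log 2 (2 * (w.length + 1)) + 1))
      (sweep advance) (f, ⟨h, 1, colTape l⟩) :=
    (preserves_sweep _).safe (confined_colTape (by omega) (hlog hl))
  have hcl : Confined (Nat.log 2 (2 * (w.length + 1)) + 1)
      (⟨h, l₁.length + 1, colTape l₁⟩ : TapeStore α (Option (Col m)) w) := by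
    rw [← hlen] at hl
    exact confined_colTape (hlog hl) (hlog hl)
  by_cases hb : f.up = true ∧ b = true
  · obtain ⟨hu, rfl⟩ := hb
    have h₂ := h₂ hu
    -- Without an incoming carry the sum would be below `2 ^ l.length`, leaving no carry out.
    have hc : f.carry = true := by
      by_contra hc
      rw [Bool.not_eq_true] at hc
      have := colVal_lt none l
      simp only [hc, Bool.toNat_true, Bool.toNat_false] at h₂
      omega
    simp only [hu, hc, if_true, Bool.toNat_true, mul_one] at h₂ hv
    have hl' : 2 ^ (l₁ ++ [Option.isNone (α := Fin m)]).length ≤ 2 * (w.length + 1) := by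
      simp only [List.length_append, hlen, List.length_singleton, pow_succ]
      omega
    have happ : Big (tapeDevice _ w) M.appendCarry
        ({ f with carry := true }, ⟨h, l₁.length + 1, colTape l₁⟩)
        ({ f with carry := true }, ⟨h, (l₁ ++ [Option.isNone]).length + 1,
          colTape (l₁ ++ [Option.isNone])⟩) := by
      -- `Option.isNone` is the column with digit one for the head and zero for every pebble.
      refine .iteTrue ⟨hu, rfl⟩ (big_act.2 ⟨_, rfl, ?_⟩)
      simp [Device.run, tapeDevice, Move.onInput, Move.onWork, update_colTape_length]
    refine ⟨true, l₁ ++ [Option.isNone], .seq hsw (.seq happ (big_rewind _ h _)), ?_,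
      fun i => ?_, hl', ?_⟩
    · rw [colVal_append_singleton, hlen]
      simp
      omega
    · rw [colVal_append_singleton, h₁]
      simp
    · refine Safe.seq hsafe fun s' hs' => ?_
      obtain rfl := hs'.unique (det_sweep _) hsw
      refine Safe.seq ?_ fun s' hs' => ?_
      · refine Safe.ite hcl (fun _ => Safe.act hcl fun s' hs' => ?_) fun hn => absurd ⟨hu, rfl⟩ hn
        obtain rfl := (Big.iteTrue ⟨hu, rfl⟩ hs').unique M.det_appendCarry happ
        exact confined_colTape (hlog hl') (hlog hl')
      · obtain rfl := hs'.unique M.det_appendCarry happ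
        exact safe_rewind (hlog hl')
  · have happ : Big (tapeDevice _ w) M.appendCarry
        ({ f with carry := b }, ⟨h, l₁.length + 1, colTape l₁⟩)
        ({ f with carry := b }, ⟨h, l₁.length + 1, colTape l₁⟩) :=
      .iteFalse hb .skip
    refine ⟨b, l₁, .seq hsw (.seq happ (big_rewind _ h _)), ?_, h₁, by rwa [hlen], ?_⟩
    -- No carry is left when counting up, and none when counting down either: a borrow out would
    -- need the old position to be zero, against `hpos`.
    · have := colVal_lt none l
      cases hu : f.up <;> cases hc : f.carry <;> cases b <;> simp_all <;> omega
    · refine Safe.seq hsafe fun s' hs' => ?_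
      obtain rfl := hs'.unique (det_sweep _) hsw
      refine Safe.seq ?_ fun s' hs' => ?_
      · exact Safe.ite hcl (fun hn => absurd hn hb) fun _ => Preserves.safe (p := .skip) trivial hcl
      · obtain rfl := hs'.unique M.det_appendCarry happ
        exact safe_rewind (hlog (by rwa [hlen]))

/-- The relation between the configurations of a pebble automaton and the states of the program
that simulates it. -/
def Represents (x : M.Cfg w) (s : HeadMem M.Q m × TapeStore α (Option (Col m)) w) : Prop :=
  ∃ l, s.2 = ⟨x.head, 1, colTape l⟩ ∧ s.1.state = x.state ∧ s.1.avail = x.available ∧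
    colVal none l = x.head.val ∧ (∀ i c, x.pebble i = some c → colVal (some i) l = c.val) ∧
    2 ^ l.length ≤ 2 * (w.length + 1)

theorem disjoint_here_available (x : M.Cfg w) : Disjoint x.here x.available := by
  rw [Finset.disjoint_left]
  intro i hi hn
  simp only [Cfg.here, Cfg.available, Finset.mem_filter] at hi hn
  rw [hi.2] at hn
  cases hn.2

/-- The effect of a transition on a configuration. -/
def Cfg.apply (x : M.Cfg w) (p : M.Q) (D K : Finset (Fin m)) (ε : Move) : M.Cfg w where
  state := p
  head := ε.onInput x.head
  pebble := fun i => if i ∈ D then some x.head else if i ∈ K then none else x.pebble i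

theorem step_iff (x x' : M.Cfg w) : M.Step w x x' ↔ ∃ p D K ε,
    (p, D, K, ε) ∈ M.δ x.state (scan w x.head) x.here x.available ∧ x' = x.apply p D K ε := by
  unfold Step Cfg.apply
  refine exists_congr fun p => exists_congr fun D => exists_congr fun K => exists_congr fun ε =>
    and_congr Iff.rfl ?_
  obtain ⟨q, h, b⟩ := x'
  rw [Cfg.mk.injEq, funext_iff]

/-- Comparison and update are deterministic, so the choice of a transition is the only branching,
and it matches the branching of the automaton. -/
theorem Represents.simulateStep {x : M.Cfg w}
    {s : HeadMem M.Q m × TapeStore α (Option (Col m)) w} (hs : Represents x s) :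
    (∀ s', Big (tapeDevice _ w) M.simulateStep s s' → ∃ x', M.Step w x x' ∧ Represents x' s') ∧
    (∀ x', M.Step w x x' → ∃ s', Big (tapeDevice _ w) M.simulateStep s s' ∧ Represents x' s') ∧
    Safe (tapeDevice _ w) (Confined (Nat.log 2 (2 * (w.length + 1)) + 1)) M.simulateStep s := by
  obtain ⟨f, s⟩ := s
  obtain ⟨l, rfl, hstate, havail, hhead, hpeb, hlen⟩ := hs
  dsimp only at hstate havail
  have hlog : l.length + 1 ≤ Nat.log 2 (2 * (w.length + 1)) + 1 :=
    Nat.succ_le_succ (Nat.le_log_of_pow_le one_lt_two hlen)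
  have hcmp := big_comparePebbles f x.head l
  -- The digits of an available pebble are stale and may agree with the head by accident; such
  -- pebbles are removed.
  have hsame : (Finset.univ.filter fun i => colVal (some i) l = colVal none l) \ f.avail =
      x.here := by
    ext i
    simp only [havail, Cfg.available, Cfg.here, Finset.mem_sdiff, Finset.mem_filter,
      Finset.mem_univ, true_and]
    cases hi : x.pebble i with
    | none => simp
    | some c => simp [hpeb i c hi, hhead, Fin.ext_iff]
  generalize hf₁ : ({ f with same := Finset.univ } : HeadMem M.Q m).compared l = f₁ at hcmp
  have hchoose : ∀ s', Big (tapeDevice _ w) M.chooseTransition (f₁, ⟨x.head, 1, colTape l⟩) s' ↔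
      ∃ p D K ε, (p, D, K, ε) ∈ M.δ x.state (scan w x.head) x.here x.available ∧
        s' = (⟨p, K, f₁.same, D, ε.isRight,
          ε.leaves (scan w x.head)⟩, ⟨ε.onInput x.head, 1, colTape l⟩) := by
    intro s'
    obtain ⟨g, s'⟩ := s'
    subst hf₁
    rw [havail] at hsame
    rw [chooseTransition, big_act]
    simp only [tapeDevice, compared, hsame, hstate, havail, Set.mem_ofPred_eq]
    constructor
    · rintro ⟨a, ⟨p, D, K, ε, h, e⟩, rfl⟩
      cases e
      exact ⟨p, D, K, ε, h, by simp [Device.run, Move.onWork]⟩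
    · rintro ⟨p, D, K, ε, h, e⟩
      cases e
      exact ⟨_, ⟨p, D, K, ε, h, rfl⟩, by simp [Device.run, Move.onWork]⟩
  have hupdate : ∀ p D K ε, (p, D, K, ε) ∈ M.δ x.state (scan w x.head) x.here x.available →
      ∃ s', Big (tapeDevice _ w) M.updatePositions
        (⟨p, K, f₁.same, D, ε.isRight,
          ε.leaves (scan w x.head)⟩, ⟨ε.onInput x.head, 1, colTape l⟩) s' ∧
        Represents (x.apply p D K ε) s' ∧
        Safe (tapeDevice _ w) (Confined (Nat.log 2 (2 * (w.length + 1)) + 1)) M.updatePositions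
          (⟨p, K, f₁.same, D, ε.isRight,
            ε.leaves (scan w x.head)⟩, ⟨ε.onInput x.head, 1, colTape l⟩) := by
    intro p D K ε h
    obtain ⟨hDK, hdis⟩ := M.pebbles_preserved _ _ _ _ (disjoint_here_available x) p D K ε h
    have hcarry : ε.leaves (scan w x.head) = true → ε.isRight = false → 0 < colVal none l := by
      intro h₁ h₂
      rw [hhead]
      cases ε with
      | left => exact pos_of_leaves_left h₁
      | stay => cases h₁
      | right => cases h₂
    obtain ⟨b, l', h₁, h₂, h₃, h₄, h₅⟩ := exists_big_updatePositions (M := M)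
      ⟨p, K, f₁.same, D, ε.isRight, ε.leaves (scan w x.head)⟩ (ε.onInput x.head)
      (ε.onInput x.head) l (by rw [onInput_val, hhead]) hcarry hlen
    refine ⟨_, h₁, ⟨l', rfl, rfl, ?_, h₂, ?_, h₄⟩, h₅⟩
    -- Here the conservation law for pebbles is needed: one that is in neither `D` nor `K` lies on
    -- another cell, so `K` is exactly the new set of available pebbles.
    · ext i
      have hi := Finset.ext_iff.1 hDK i
      have hi' := fun h : i ∈ D => Finset.disjoint_left.1 hdis h
      simp only [Finset.mem_union, Cfg.available, Cfg.here, Finset.mem_filter,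
        Finset.mem_univ, true_and] at hi
      rw [Cfg.available, Finset.mem_filter]
      simp only [Cfg.apply, Finset.mem_univ, true_and]
      split_ifs <;> simp_all
    · intro i c hc
      rw [h₃]
      simp only [Cfg.apply] at hc ⊢
      split_ifs at hc ⊢ with hD
      · cases hc
        exact hhead
      · exact hpeb i c hc
  refine ⟨fun s' hs' => ?_, fun x' hx' => ?_, ?_⟩
  · obtain ⟨r₁, hr₁, hs'⟩ := big_seq.1 hs'
    obtain rfl := hr₁.unique M.det_comparePebbles hcmp
    obtain ⟨r₂, hr₂, hs'⟩ := big_seq.1 hs'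
    obtain ⟨p, D, K, ε, h, rfl⟩ := (hchoose _).1 hr₂
    obtain ⟨r, hr, hR, -⟩ := hupdate p D K ε h
    obtain rfl := hs'.unique M.det_updatePositions hr
    exact ⟨_, (step_iff _ _).2 ⟨p, D, K, ε, h, rfl⟩, hR⟩
  · obtain ⟨p, D, K, ε, h, rfl⟩ := (step_iff _ _).1 hx'
    obtain ⟨r, hr, hR, -⟩ := hupdate p D K ε h
    exact ⟨r, .seq hcmp (.seq ((hchoose _).2 ⟨p, D, K, ε, h, rfl⟩) hr), hR⟩
  · refine Safe.seq (safe_comparePebbles _ _ hlog) fun s' hs' => ?_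
    obtain rfl := hs'.unique M.det_comparePebbles hcmp
    have hc : ∀ h, Confined (Nat.log 2 (2 * (w.length + 1)) + 1)
        (⟨h, 1, colTape l⟩ : TapeStore α (Option (Col m)) w) := fun h =>
      confined_colTape (by omega) hlog
    refine Safe.seq (Safe.act (hc _) fun s' hs' => ?_) fun s' hs' => ?_
    · obtain ⟨p, D, K, ε, h, rfl⟩ := (hchoose _).1 hs'
      exact hc _
    · obtain ⟨p, D, K, ε, h, rfl⟩ := (hchoose _).1 hs'
      obtain ⟨r, -, -, h⟩ := hupdate p D K ε h
      exact h

theorem represents_init (f : HeadMem M.Q m) (hf : f.state = M.start)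
    (hf' : f.avail = Finset.univ) :
    Represents (M.init w) (f, ⟨0, 1, colTape []⟩) := by
  refine ⟨[], rfl, hf, ?_, rfl, fun i c hc => ?_, ?_⟩
  · simp [hf', Cfg.available, init]
  · cases hc
  · simp
    omega

theorem colTape_nil : colTape ([] : List (Col m)) = fun _ => none := by
  funext i
  cases i <;> simp [colTape]

/-- The initial memory for the simulation. -/
def initMem (M : PebbleAutomaton α m) : HeadMem M.Q m :=
  ⟨M.start, Finset.univ, ∅, ∅, false, false⟩

/-- For positive `n` the left side is at most `Nat.log 2 n + 3`. -/
theorem log_lt_bound (n : ℕ) : Nat.log 2 (2 * (n + 1)) + 1 < 4 * (Nat.log 2 n + 1) := by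
  have h₁ : Nat.log 2 (2 * (n + 1)) = Nat.log 2 (n + 1) + 1 := by
    rw [mul_comm, Nat.log_mul_base one_lt_two (by omega)]
  rcases Nat.eq_zero_or_pos n with rfl | hn
  · simp [h₁]
  · have h₂ : Nat.log 2 (n + 1) ≤ Nat.log 2 n + 1 := by
      rw [← Nat.log_mul_base one_lt_two (by omega)]
      exact Nat.log_mono_right (by omega)
    omega

variable (M)

theorem exists_turingMachine : ∃ T : TuringMachine α 1, (M.IsDeterministic → T.IsDeterministic) ∧
    T.IsLogspace ∧ T.language = M.language := by
  have := M.finite_Q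
  have hmove (w : List α) := big_moveWork (w := w) (m := m) Move.right M.initMem
    ⟨0, 0, fun _ => none⟩
  have hinit (w : List α) := represents_init (w := w) M.initMem rfl rfl
  rw [colTape_nil] at hinit
  refine ⟨M.simulation.toTuring none M.initMem,
    fun hM => toTuring_isDeterministic (M.det_simulation hM), ⟨4, ?_⟩, ?_⟩
  · refine toTuring_spaceBound fun w y hy => lt_of_le_of_lt ?_ (log_lt_bound w.length)
    suffices H : Safe (tapeDevice _ w) (Confined (Nat.log 2 (2 * (w.length + 1)) + 1))
      M.simulation (M.initMem, ⟨0, 0, fun _ => none⟩) from (H y hy).1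
    refine Safe.seq (Safe.act ⟨Nat.zero_le _, fun _ _ => rfl⟩ fun s' hs' => ?_) fun s' hs' => ?_
    · obtain rfl := hs'.unique (det_moveWork Move.right) (hmove w)
      exact ⟨by simp [Move.onWork], fun _ _ => rfl⟩
    · obtain rfl := hs'.unique (det_moveWork Move.right) (hmove w)
      -- The loop invariant is that some configuration is represented; this already bounds the
      -- number of columns.
      refine Safe.loop (fun s => ∃ x : M.Cfg w, Represents x s) ?_ ?_ ⟨_, hinit w⟩
      · rintro ⟨f, s⟩ ⟨x, l, rfl, -, -, -, -, h⟩
        exact confined_colTape (by omega)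
          (Nat.succ_le_succ (Nat.le_log_of_pow_le one_lt_two h))
      · rintro s ⟨x, hx⟩ -
        refine ⟨hx.simulateStep.2.2, fun s' hs' => ?_⟩
        obtain ⟨x', -, hx'⟩ := hx.simulateStep.1 s' hs'
        exact ⟨x', hx'⟩
  · ext w
    rw [mem_language_toTuring]
    have key := exists_big_loop_iff (d := tapeDevice (Option (Col m)) w) (step := M.Step w)
      (acc := fun x => x.state ∈ M.accept) Represents
      (t := fun f _ => f.state ∉ M.accept) (p := M.simulateStep) ?_
      (fun x s s' hx => hx.simulateStep.1 s') (fun x s x' hx => hx.simulateStep.2.1 x') (hinit w)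
    · refine Iff.trans ?_ key
      refine exists_congr fun s' => ?_
      rw [simulation, big_seq]
      constructor
      · rintro ⟨r, hr, h⟩
        obtain rfl := hr.unique (det_moveWork Move.right) (hmove w)
        exact h
      · exact fun h => ⟨_, hmove w, h⟩
    · rintro x s ⟨l, -, hs, -⟩
      rw [hs]

end PebbleAutomaton

/-! ### Registers on the input tape of a pebble automaton -/

namespace Prog

variable {α : Type*} {F : Type} {N : ℕ} {w : List α}

/-- Programs for a pebble automaton. -/
abbrev PebbleProg (α : Type*) (F : Type) (N : ℕ) := Prog F (PebbleObs α N) (PebbleAct N)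

/-- The store in which the pebbles lie on the cells given by `v`. -/
def cellStore (v : Fin N → Cell w) (h : Cell w) : PebbleStore α N w :=
  ⟨h, fun i => some (v i)⟩

theorem obs_cellStore (v : Fin N → Cell w) (h : Cell w) :
    (pebbleDevice N w).obs (cellStore v h) =
      (scan w h, Finset.univ.filter fun i => v i = h, ∅) := by
  simp [pebbleDevice, cellStore]

/-- Move the head and leave the pebbles where they are. -/
def moveHead (ε : Move) : PebbleProg α F N :=
  .act fun f o => {(f, some (o.2.1, ε))}

theorem big_moveHead (ε : Move) (f : F) (v : Fin N → Cell w) (h : Cell w) :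
    Big (pebbleDevice N w) (moveHead ε) (f, cellStore v h)
      (f, cellStore v (ε.onInput h)) := by
  refine big_act.2 ⟨_, rfl, ?_⟩
  simp only [obs_cellStore]
  simp only [Device.run, pebbleDevice, cellStore, PebbleStore.mk.injEq, true_and]
  funext i
  by_cases hi : v i = h <;> simp [hi]

/-- Move the head to the right until it reaches pebble `r`. -/
def seek (r : Fin N) : PebbleProg α F N :=
  .loop (fun _ o => r ∉ o.2.1) (moveHead Move.right)

/-- Move the head to the left end of the tape. -/
def goHome : PebbleProg α F N :=
  .loop (fun _ o => o.1 ≠ Symbol.leftEnd) (moveHead Move.left)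

theorem big_seek (r : Fin N) (f : F) (v : Fin N → Cell w) :
    Big (pebbleDevice N w) (seek r) (f, cellStore v 0) (f, cellStore v (v r)) := by
  have hr := (v r).isLt
  have := big_loop_of_sequence (d := pebbleDevice N w) (t := fun (_ : F) o => r ∉ o.2.1)
    (p := moveHead Move.right) (v r).val
    -- The minimum only makes the cell valid for every `i`.
    (fun i => (f, cellStore v ⟨min i (v r).val, by omega⟩)) ?_ ?_ ?_
  · rw [seek]
    simpa using this
  · intro i hi
    simp [obs_cellStore, Fin.ext_iff]
    omega
  · simp [obs_cellStore]
  · intro i hi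
    convert big_moveHead Move.right f v _ using 4
    simp only [Move.onInput]
    omega

theorem big_goHome (f : F) (v : Fin N → Cell w) (h : Cell w) :
    Big (pebbleDevice N w) goHome (f, cellStore v h) (f, cellStore v 0) := by
  have := big_loop_of_sequence (d := pebbleDevice N w)
    (t := fun (_ : F) o => o.1 ≠ Symbol.leftEnd) (p := moveHead Move.left) h.val
    (fun i => (f, cellStore v ⟨h.val - i, by omega⟩)) ?_ ?_ ?_
  · rw [goHome]
    simpa using this
  · intro i hi
    simp [obs_cellStore, scan_eq_leftEnd_iff]
    omega
  · simp [obs_cellStore, scan_eq_leftEnd_iff]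
  · intro i hi
    exact big_moveHead Move.left f v _

/-- Put down all pebbles at hand. -/
def dropPebbles : PebbleProg α F N :=
  .act fun f o => {(f, some (o.2.1 ∪ o.2.2, Move.stay))}

theorem det_dropPebbles : (dropPebbles : PebbleProg α F N).Det :=
  fun _ _ => Set.subsingleton_singleton

/-- Move pebble `r` in a direction that depends on the memory and on the symbol in its cell, and
change the memory. -/
def movePebble (r : Fin N) (u : F → Symbol α → Set (F × Move)) : PebbleProg α F N :=
  .seq (seek r) (.seq
    (.act fun f o => {x | ∃ f' ε, (f', ε) ∈ u f o.1 ∧ x = (f', some (o.2.1.erase r, ε))})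
    (.seq dropPebbles goHome))

theorem det_moveHead (ε : Move) : (moveHead ε : PebbleProg α F N).Det :=
  fun _ _ => Set.subsingleton_singleton

theorem det_seek (r : Fin N) : (seek r : PebbleProg α F N).Det := det_moveHead Move.right

theorem det_goHome : (goHome : PebbleProg α F N).Det := det_moveHead Move.left

theorem det_movePebble {r : Fin N} {u : F → Symbol α → Set (F × Move)}
    (hu : ∀ f a, (u f a).Subsingleton) : (movePebble r u).Det := by
  refine ⟨det_seek r, ?_, det_dropPebbles, det_goHome⟩
  rintro f o _ ⟨f₁, ε₁, h₁, rfl⟩ _ ⟨f₂, ε₂, h₂, rfl⟩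
  cases hu _ _ h₁ h₂
  rfl

/-- Pebble `r` is picked up, the head moves, and everything at hand is put down. All other pebbles
are on the tape, so `r` is the only one that changes its place. -/
theorem big_movePebble {r : Fin N} {u : F → Symbol α → Set (F × Move)} {f : F}
    {v : Fin N → Cell w} {s' : F × PebbleStore α N w} :
    Big (pebbleDevice N w) (movePebble r u) (f, cellStore v 0) s' ↔
      ∃ f' ε, (f', ε) ∈ u f (scan w (v r)) ∧
        s' = (f', cellStore (Function.update v r (ε.onInput (v r))) 0) := by
  have hlift : ∀ ε : Move, (pebbleDevice N w).run
      (some (((pebbleDevice N w).obs (cellStore v (v r))).2.1.erase r, ε))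
      (cellStore v (v r)) =
      ⟨ε.onInput (v r), fun i => if i = r then none else some (v i)⟩ := by
    intro ε
    rw [obs_cellStore]
    simp only [Device.run, pebbleDevice, cellStore, PebbleStore.mk.injEq, true_and]
    funext i
    by_cases hi : v i = v r <;> by_cases hir : i = r <;> simp_all
  have hdrop : ∀ (f' : F) (h : Cell w), Big (pebbleDevice N w) dropPebbles
      (f', ⟨h, fun i => if i = r then none else some (v i)⟩)
      (f', cellStore (Function.update v r h) h) := by
    intro f' h
    refine big_act.2 ⟨_, rfl, ?_⟩
    simp only [Device.run, pebbleDevice, cellStore, PebbleStore.mk.injEq, Move.onInput, true_and]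
    funext i
    by_cases hi : v i = h <;> by_cases hir : i = r <;> simp_all
  constructor
  · intro h
    obtain ⟨r₁, h₁, h⟩ := big_seq.1 h
    obtain rfl := h₁.unique (det_seek r) (big_seek r f v)
    obtain ⟨⟨f₂, r₂⟩, h₂, h⟩ := big_seq.1 h
    obtain ⟨a, ⟨f', ε, hu, e⟩, hr₂⟩ := big_act.1 h₂
    cases e
    rw [hlift] at hr₂
    dsimp only at hr₂
    subst hr₂
    obtain ⟨r₃, h₃, h⟩ := big_seq.1 h
    obtain rfl := h₃.unique det_dropPebbles (hdrop f₂ _)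
    obtain rfl := h.unique det_goHome (big_goHome f₂ _ _)
    rw [obs_cellStore] at hu
    exact ⟨f₂, ε, hu, rfl⟩
  · rintro ⟨f', ε, hu, rfl⟩
    refine .seq (big_seek r f v) (.seq (s' := (f', _)) (big_act.2 ⟨_, ⟨f', ε, ?_, rfl⟩,
      (hlift ε).symm⟩) (.seq (hdrop f' _) (big_goHome f' _ _)))
    rw [obs_cellStore]
    exact hu

/-! ### Arithmetic on registers held by pebbles -/

section Registers

variable {R : Type*} (e : R ≃ Fin N)

/-- The store in which register `r` holds `x r`: the pebble of the register lies on the cell with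
this number. -/
def regStore (w : List α) (x : R → ℕ) : PebbleStore α N w :=
  cellStore (fun i => ⟨min (x (e.symm i)) (w.length + 1), by omega⟩) 0

/-- Register `r` does not hold zero. -/
def nonzero (r : R) : F → PebbleObs α N → Prop := fun _ o => e r ∉ o.2.1

/-- Increase a register by one. -/
def inc (r : R) : PebbleProg α F N := movePebble (e r) fun f _ => {(f, Move.right)}

/-- Decrease a register by one. -/
def dec (r : R) : PebbleProg α F N := movePebble (e r) fun f _ => {(f, Move.left)}

theorem det_inc (r : R) : (inc e r : PebbleProg α F N).Det :=
  det_movePebble fun _ _ => Set.subsingleton_singleton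

theorem det_dec (r : R) : (dec e r : PebbleProg α F N).Det :=
  det_movePebble fun _ _ => Set.subsingleton_singleton

/-- Add register `T` to register `A`, and clear `T`. -/
def moveBack (A T : R) : PebbleProg α F N := .loop (nonzero e T) (.seq (dec e T) (inc e A))

/-- Append the binary digit `bit` to the number in register `A`. The register `T` has to hold
zero. -/
def push (A T : R) (bit : F → Bool) : PebbleProg α F N :=
  .seq (.loop (nonzero e A) (.seq (dec e A) (.seq (inc e T) (inc e T))))
    (.seq (moveBack e A T) (.ite (fun f _ => bit f = true) (inc e A) .skip))

/-- Remove the last binary digit of the number in register `A` and store it by means of `set`. The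
register `T` has to hold zero. -/
def pop (A T : R) (set : Bool → F → F) : PebbleProg α F N :=
  .seq (.act fun f _ => {(set false f, none)})
    (.seq (.loop (nonzero e A) (.seq (dec e A) (.ite (nonzero e A) (.seq (dec e A) (inc e T))
        (.act fun f _ => {(set true f, none)}))))
      (moveBack e A T))

theorem det_moveBack (A T : R) : (moveBack e A T : PebbleProg α F N).Det :=
  ⟨det_dec e T, det_inc e A⟩

theorem det_push (A T : R) (bit : F → Bool) : (push e A T bit : PebbleProg α F N).Det :=
  ⟨⟨det_dec e A, det_inc e T, det_inc e T⟩, det_moveBack e A T, det_inc e A, trivial⟩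

theorem det_pop (A T : R) (set : Bool → F → F) : (pop e A T set : PebbleProg α F N).Det :=
  ⟨fun _ _ => Set.subsingleton_singleton,
    ⟨det_dec e A, ⟨det_dec e A, det_inc e T⟩, fun _ _ => Set.subsingleton_singleton⟩,
    det_moveBack e A T⟩

variable {e}

/-- Between operations the head rests on cell `0`, so the pebbles in sight are those of the
registers that hold zero. -/
theorem nonzero_iff (f : F) (x : R → ℕ) (r : R) :
    nonzero e r f ((pebbleDevice N w).obs (regStore e w x)) ↔ x r ≠ 0 := by
  rw [regStore, obs_cellStore]
  simp [nonzero, Fin.ext_iff]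

variable [DecidableEq R]

theorem update_regStore (x : R → ℕ) (r : R) (c : Cell w) (y : ℕ) (hy : min y (w.length + 1) = c) :
    (cellStore (Function.update (fun i => ⟨min (x (e.symm i)) (w.length + 1), by omega⟩) (e r) c) 0
      : PebbleStore α N w) = regStore e w (Function.update x r y) := by
  unfold regStore
  congr 1
  funext i
  obtain ⟨r', rfl⟩ := e.surjective i
  by_cases h : r' = r
  · subst h
    simp [hy]
  · simp [h]

/-- No bound is required: `regStore` truncates at `w.length + 1`, as does a right move at the
endmarker. Decreasing does require one, since truncation loses the excess. -/
theorem big_inc (f : F) (x : R → ℕ) (r : R) :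
    Big (pebbleDevice N w) (inc e r) (f, regStore e w x)
      (f, regStore e w (Function.update x r (x r + 1))) := by
  refine big_movePebble.2 ⟨f, Move.right, rfl, ?_⟩
  rw [update_regStore]
  simp [Move.onInput]

theorem big_dec (f : F) (x : R → ℕ) (r : R) (hx : x r ≤ w.length + 1) :
    Big (pebbleDevice N w) (dec e r) (f, regStore e w x)
      (f, regStore e w (Function.update x r (x r - 1))) := by
  refine big_movePebble.2 ⟨f, Move.left, rfl, ?_⟩
  rw [update_regStore]
  simp [Move.onInput]
  omega

/-- The registers `x` with the values of `A` and `T` replaced by `a` and `t`. -/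
def setTwo (x : R → ℕ) (A T : R) (a t : ℕ) : R → ℕ :=
  Function.update (Function.update x A a) T t

variable {A T : R}

theorem setTwo_eq_update (x : R → ℕ) (hT : x T = 0) (hAT : A ≠ T) (a : ℕ) :
    setTwo x A T a 0 = Function.update x A a := by
  rw [setTwo, Function.update_eq_iff]
  refine ⟨?_, fun _ _ => rfl⟩
  rw [Function.update_of_ne hAT.symm, hT]

theorem setTwo_fst (x : R → ℕ) (hAT : A ≠ T) (a t : ℕ) : setTwo x A T a t A = a := by
  simp [setTwo, hAT]

theorem setTwo_snd (x : R → ℕ) (a t : ℕ) : setTwo x A T a t T = t := by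
  simp [setTwo]

theorem update_setTwo_fst (x : R → ℕ) (hAT : A ≠ T) (a t b : ℕ) :
    Function.update (setTwo x A T a t) A b = setTwo x A T b t := by
  rw [setTwo, Function.update_comm hAT.symm, Function.update_idem, setTwo]

theorem update_setTwo_snd (x : R → ℕ) (a t b : ℕ) :
    Function.update (setTwo x A T a t) T b = setTwo x A T a b := by
  rw [setTwo, Function.update_idem, setTwo]

theorem big_inc_fst (f : F) (x : R → ℕ) (hAT : A ≠ T) (a t : ℕ) :
    Big (pebbleDevice N w) (inc e A) (f, regStore e w (setTwo x A T a t))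
      (f, regStore e w (setTwo x A T (a + 1) t)) := by
  have := big_inc (w := w) (e := e) f (setTwo x A T a t) A
  rwa [setTwo_fst x hAT, update_setTwo_fst x hAT] at this

theorem big_inc_snd (f : F) (x : R → ℕ) (a t : ℕ) :
    Big (pebbleDevice N w) (inc e T) (f, regStore e w (setTwo x A T a t))
      (f, regStore e w (setTwo x A T a (t + 1))) := by
  have := big_inc (w := w) (e := e) f (setTwo x A T a t) T
  rwa [setTwo_snd x, update_setTwo_snd x] at this

theorem big_dec_fst (f : F) (x : R → ℕ) (hAT : A ≠ T) (a t : ℕ) (ha : a + 1 ≤ w.length + 1) :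
    Big (pebbleDevice N w) (dec e A) (f, regStore e w (setTwo x A T (a + 1) t))
      (f, regStore e w (setTwo x A T a t)) := by
  have := big_dec (w := w) (e := e) f (setTwo x A T (a + 1) t) A (by rwa [setTwo_fst x hAT])
  rwa [setTwo_fst x hAT, update_setTwo_fst x hAT] at this

theorem big_dec_snd (f : F) (x : R → ℕ) (a t : ℕ) (ht : t + 1 ≤ w.length + 1) :
    Big (pebbleDevice N w) (dec e T) (f, regStore e w (setTwo x A T a (t + 1)))
      (f, regStore e w (setTwo x A T a t)) := by
  have := big_dec (w := w) (e := e) f (setTwo x A T a (t + 1)) T (by rwa [setTwo_snd x])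
  rwa [setTwo_snd x, update_setTwo_snd x] at this

theorem big_moveBack (f : F) (x : R → ℕ) (hAT : A ≠ T) (a t : ℕ) (ht : t ≤ w.length + 1) :
    Big (pebbleDevice N w) (moveBack e A T) (f, regStore e w (setTwo x A T a t))
      (f, regStore e w (setTwo x A T (a + t) 0)) := by
  induction t generalizing a with
  | zero =>
    refine .loopFalse ?_
    rw [nonzero_iff, setTwo_snd]
    simp
  | succ t ih =>
    have h := ih (a + 1) (by omega)
    rw [Nat.add_right_comm] at h
    refine .loopTrue ?_ (.seq (big_dec_snd f x a t ht) (big_inc_fst f x hAT a t)) h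
    rw [nonzero_iff, setTwo_snd]
    simp

/-- Each unit taken from `A` puts two into `T`, which is then emptied back into `A`; the bound on `2
* x A` lets `T` hold the double. -/
theorem big_push (f : F) (x : R → ℕ) (hT : x T = 0) (hAT : A ≠ T) (bit : F → Bool)
    (hx : 2 * x A ≤ w.length + 1) :
    Big (pebbleDevice N w) (push e A T bit) (f, regStore e w x)
      (f, regStore e w (Function.update x A (2 * x A + (bit f).toNat))) := by
  have hdouble : ∀ a t, a ≤ w.length + 1 → Big (pebbleDevice N w)
      (.loop (nonzero e A) (.seq (dec e A) (.seq (inc e T) (inc e T))))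
      (f, regStore e w (setTwo x A T a t)) (f, regStore e w (setTwo x A T 0 (t + 2 * a))) := by
    intro a
    induction a with
    | zero =>
      intro t _
      refine .loopFalse ?_
      rw [nonzero_iff, setTwo_fst x hAT]
      simp
    | succ a ih =>
      intro t ha
      have h := ih (t + 1 + 1) (by omega)
      rw [show t + 1 + 1 + 2 * a = t + 2 * (a + 1) by ring] at h
      refine .loopTrue ?_ (.seq (big_dec_fst f x hAT a t ha)
        (.seq (big_inc_snd f x a t) (big_inc_snd f x a (t + 1)))) h
      rw [nonzero_iff, setTwo_fst x hAT]
      simp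
  have h₁ := hdouble (x A) 0 (by omega)
  have h₂ := big_moveBack (w := w) (e := e) f x hAT 0 (0 + 2 * x A) (by omega)
  rw [setTwo_eq_update x hT hAT, Function.update_eq_self] at h₁
  rw [Nat.zero_add, Nat.zero_add] at h₂
  rw [Nat.zero_add] at h₁
  refine .seq h₁ (.seq h₂ ?_)
  cases hb : bit f with
  | false =>
    rw [setTwo_eq_update x hT hAT]
    exact .iteFalse (by simp [hb]) .skip
  | true =>
    have h := big_inc_fst (w := w) (e := e) f x hAT (2 * x A) 0
    rw [setTwo_eq_update x hT hAT (2 * x A + 1)] at h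
    exact .iteTrue (by simp [hb]) h

/-- Units leave `A` in pairs, each pair adding one to `T`; an unpaired last unit is the digit one.
The digit is first set to zero and possibly overwritten, whence `hset`. -/
theorem big_pop (f : F) (x : R → ℕ) (hT : x T = 0) (hAT : A ≠ T) (set : Bool → F → F)
    (hset : ∀ b b', set b (set b' f) = set b f) (hx : x A ≤ w.length + 1) :
    Big (pebbleDevice N w) (pop e A T set) (f, regStore e w x)
      (set (decide (x A % 2 = 1)) f, regStore e w (Function.update x A (x A / 2))) := by
  have hhalve : ∀ a t, a ≤ w.length + 1 → Big (pebbleDevice N w)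
      (.loop (nonzero e A) (.seq (dec e A) (.ite (nonzero e A) (.seq (dec e A) (inc e T))
        (.act fun f _ => {(set true f, none)}))))
      (set false f, regStore e w (setTwo x A T a t))
      (set (decide (a % 2 = 1)) f, regStore e w (setTwo x A T 0 (t + a / 2))) := by
    intro a
    induction a using Nat.twoStepInduction with
    | zero =>
      intro t _
      refine .loopFalse ?_
      rw [nonzero_iff, setTwo_fst x hAT]
      simp
    | one =>
      intro t ha
      have h : Big (pebbleDevice N w) (.act fun f _ => {(set true f, none)})
          (set false f, regStore e w (setTwo x A T 0 t))
          (set true f, regStore e w (setTwo x A T 0 t)) := by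
        refine big_act.2 ⟨none, ?_, rfl⟩
        rw [hset]
        exact rfl
      refine .loopTrue ?_ (.seq (big_dec_fst _ x hAT 0 t ha) (.iteFalse ?_ h)) (.loopFalse ?_)
      · rw [nonzero_iff, setTwo_fst x hAT]
        simp
      · rw [nonzero_iff, setTwo_fst x hAT]
        simp
      · rw [nonzero_iff, setTwo_fst x hAT]
        simp
    | more a ih _ =>
      intro t ha
      have h := ih (t + 1) (by omega)
      rw [show t + 1 + a / 2 = t + (a + 2) / 2 by omega,
        show a % 2 = (a + 2) % 2 by omega] at h
      refine .loopTrue ?_ (.seq (big_dec_fst _ x hAT (a + 1) t ha) (.iteTrue ?_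
        (.seq (big_dec_fst _ x hAT a t (by omega)) (big_inc_snd _ x a t)))) h
      · rw [nonzero_iff, setTwo_fst x hAT]
        simp
      · rw [nonzero_iff, setTwo_fst x hAT]
        simp
  have h₁ := hhalve (x A) 0 hx
  have h₂ := big_moveBack (w := w) (e := e) (set (decide (x A % 2 = 1)) f) x hAT 0
    (0 + x A / 2) (by omega)
  rw [setTwo_eq_update x hT hAT, Function.update_eq_self] at h₁
  rw [Nat.zero_add, Nat.zero_add, setTwo_eq_update x hT hAT] at h₂
  rw [Nat.zero_add] at h₁
  have h₀ : Big (pebbleDevice N w) (.act fun f _ => {(set false f, none)})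
      (f, regStore e w x) (set false f, regStore e w x) := big_act.2 ⟨none, rfl, rfl⟩
  exact .seq h₀ (.seq h₁ h₂)

end Registers

end Prog

/-! ### Simulation of a Turing machine by a pebble automaton -/

section Stacks

/-- The number with binary digits `b 0, …, b (o - 1)`, most significant digit first. -/
def leftVal (b : ℕ → Bool) : ℕ → ℕ
  | 0 => 0
  | o + 1 => 2 * leftVal b o + (b o).toNat

/-- The number with binary digits `b o, …, b (o + d - 1)`, least significant digit first. -/
def rightVal (b : ℕ → Bool) : ℕ → ℕ → ℕ
  | _, 0 => 0
  | o, d + 1 => (b o).toNat + 2 * rightVal b (o + 1) d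

theorem leftVal_lt (b : ℕ → Bool) (o : ℕ) : leftVal b o < 2 ^ o := by
  induction o with
  | zero => simp [leftVal]
  | succ o ih =>
    have := (b o).toNat_le
    rw [leftVal, pow_succ]
    omega

theorem rightVal_lt (b : ℕ → Bool) (o d : ℕ) : rightVal b o d < 2 ^ d := by
  induction d generalizing o with
  | zero => simp [rightVal]
  | succ d ih =>
    have := (b o).toNat_le
    have := ih (o + 1)
    rw [rightVal, pow_succ]
    omega

theorem leftVal_congr {b b' : ℕ → Bool} {o : ℕ} (h : ∀ i < o, b i = b' i) :
    leftVal b o = leftVal b' o := by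
  induction o with
  | zero => rfl
  | succ o ih => rw [leftVal, leftVal, ih fun i hi => h i (by omega), h o (by omega)]

theorem rightVal_congr {b b' : ℕ → Bool} {o d : ℕ} (h : ∀ i, o ≤ i → b i = b' i) :
    rightVal b o d = rightVal b' o d := by
  induction d generalizing o with
  | zero => rfl
  | succ d ih => rw [rightVal, rightVal, ih fun i hi => h i (by omega), h o le_rfl]

theorem rightVal_eq_zero {b : ℕ → Bool} {o d : ℕ} (h : ∀ i, o ≤ i → b i = false) :
    rightVal b o d = 0 := by
  induction d generalizing o with
  | zero => rfl
  | succ d ih => rw [rightVal, ih fun i hi => h i (by omega), h o le_rfl]; rfl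

/-- The bit nearest to the scanned column is the least significant one, that is, the top of the
stack; for `leftVal` this is the defining equation. -/
theorem rightVal_step (b : ℕ → Bool) {o l : ℕ} (h : o < l) :
    rightVal b o (l - o) = (b o).toNat + 2 * rightVal b (o + 1) (l - (o + 1)) := by
  rw [show l - o = l - (o + 1) + 1 by omega, rightVal]

end Stacks

/-- The tracks for `k` work tapes over `Γ` that are cut into columns of `B + 1` cells. Track
`(j, none)` marks the first column of tape `j`; track `(j, some (c, γ))` marks the columns of tape
`j` whose cell `c` contains the nonblank symbol `γ`. -/
abbrev Track (k B : ℕ) (Γ : Type) := Fin k × Option (Fin (B + 1) × Γ)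

/-- The registers of the simulation: the position of the input head, an auxiliary register, and for
each track two numbers whose binary digits are the marks to the left and to the right of the
scanned column. -/
abbrev SimReg (k B : ℕ) (Γ : Type) := Bool ⊕ (Bool × Track k B Γ)

/-- The finite memory of the simulation: the state, the positions of the work heads in the scanned
columns, the marks of the scanned columns, and the moves that the work heads still have to make. -/
structure SimMem (Q Γ : Type) (k B : ℕ) where
  state : Q
  off : Fin k → Fin (B + 1)
  bits : Track k B Γ → Bool
  pending : Fin k → Move

instance {Q Γ : Type} [Finite Q] [Finite Γ] {k B : ℕ} : Finite (SimMem Q Γ k B) :=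
  have := finite_move
  Finite.of_injective
    (β := Q × (Fin k → Fin (B + 1)) × (Track k B Γ → Bool) × (Fin k → Move))
    (fun x => (x.state, x.off, x.bits, x.pending)) fun x y h => by
      cases x; cases y; simpa using h

/-! ### Tracks as pairs of stacks -/

namespace Simulation

open Prog Classical

variable {α : Type*} {Q Γ : Type} {k B N : ℕ} {w : List α} (e : SimReg k B Γ ≃ Fin N)

/-- The contents of the registers. -/
def regs (l : ℕ) (b : Track k B Γ → ℕ → Bool) (col : Track k B Γ → ℕ) (h : ℕ) :
    SimReg k B Γ → ℕ
  | .inl false => h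
  | .inl true => 0
  | .inr (false, t) => leftVal (b t) (col t)
  | .inr (true, t) => rightVal (b t) (col t + 1) (l - (col t + 1))

/-- The state of the simulation in which track `t` is `b t`, with the column `col t` scanned. -/
def simState (w : List α) (l : ℕ) (q : Q) (off : Fin k → Fin (B + 1)) (pending : Fin k → Move)
    (b : Track k B Γ → ℕ → Bool) (col : Track k B Γ → ℕ) (h : ℕ) :
    SimMem Q Γ k B × PebbleStore α N w :=
  (⟨q, off, fun t => b t (col t), pending⟩, regStore e w (regs l b col h))

/-- Move the scanned column of track `t` to the left (`true`) or to the right (`false`). -/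
noncomputable def shift (d : Bool) (t : Track k B Γ) : PebbleProg α (SimMem Q Γ k B) N :=
  .seq (push e (.inr (d, t)) (.inl true) fun f => f.bits t)
    (pop e (.inr (!d, t)) (.inl true) fun b f => { f with bits := Function.update f.bits t b })

theorem det_shift (d : Bool) (t : Track k B Γ) :
    (shift e d t : PebbleProg α (SimMem Q Γ k B) N).Det :=
  ⟨det_push _ _ _ _, det_pop _ _ _ _⟩

variable {e}
variable {l : ℕ} {q : Q} {off : Fin k → Fin (B + 1)} {pending : Fin k → Move}
  {b : Track k B Γ → ℕ → Bool} {col : Track k B Γ → ℕ} {h : ℕ}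

/-- Common core of both directions: `hpush` says that the scanned bit goes on the stack left behind,
`hpop` that the newly scanned bit `b t o` comes off the other. The last two hypotheses keep the
registers within the tape. -/
theorem big_shift {d : Bool} {t : Track k B Γ} {o : ℕ}
    (hpush : regs l b (Function.update col t o) h (.inr (d, t)) =
      2 * regs l b col h (.inr (d, t)) + (b t (col t)).toNat)
    (hpop : regs l b col h (.inr (!d, t)) =
      2 * regs l b (Function.update col t o) h (.inr (!d, t)) + (b t o).toNat)
    (h₁ : regs l b (Function.update col t o) h (.inr (d, t)) ≤ w.length + 1)
    (h₂ : regs l b col h (.inr (!d, t)) ≤ w.length + 1) :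
    Big (pebbleDevice N w) (shift e d t) (simState e w l q off pending b col h)
      (simState e w l q off pending b (Function.update col t o) h) := by
  have hp := big_push (w := w) (e := e) (A := .inr (d, t)) (T := .inl true)
    (⟨q, off, fun t => b t (col t), pending⟩ : SimMem Q Γ k B) (regs l b col h) rfl
    Sum.inr_ne_inl (fun f => f.bits t) (by omega)
  refine .seq hp ?_
  have hne : (Sum.inr (!d, t) : SimReg k B Γ) ≠ .inr (d, t) := by cases d <;> simp
  have := big_pop (w := w) (e := e) (A := .inr (!d, t)) (T := .inl true)
    (⟨q, off, fun t => b t (col t), pending⟩ : SimMem Q Γ k B)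
    (Function.update (regs l b col h) (.inr (d, t))
      (2 * regs l b col h (.inr (d, t)) + (b t (col t)).toNat)) rfl
    Sum.inr_ne_inl (fun b f => { f with bits := Function.update f.bits t b })
    (by simp) (by rwa [Function.update_of_ne hne])
  rw [Function.update_of_ne hne] at this
  have hb := (b t o).toNat_le
  have hbits : (fun t' => b t' (Function.update col t o t')) =
      Function.update (fun t' => b t' (col t')) t
        (decide (regs l b col h (Sum.inr (!d, t)) % 2 = 1)) := by
    funext t'
    by_cases ht : t' = t
    · subst ht
      rw [hpop]
      cases hbo : b t' o <;> simp [hbo]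
    · simp [ht]
  have hregs : regs l b (Function.update col t o) h =
      Function.update (Function.update (regs l b col h) (.inr (d, t))
        (2 * regs l b col h (.inr (d, t)) + (b t (col t)).toNat)) (.inr (!d, t))
          (regs l b col h (.inr (!d, t)) / 2) := by
    funext r
    rcases r with (_ | _) | ⟨d', t'⟩
    · simp [regs]
    · simp [regs]
    · by_cases ht : t' = t
      · subst ht
        by_cases hd : d' = d
        · subst hd
          rw [Function.update_of_ne hne.symm, Function.update_self, hpush]
        · obtain rfl : d' = !d := by revert hd; cases d <;> cases d' <;> decide
          rw [Function.update_self]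
          omega
      · rw [Function.update_of_ne (by simp [ht]), Function.update_of_ne (by simp [ht])]
        cases d' <;> simp [regs, ht]
  unfold simState
  rw [hbits, hregs]
  exact this

/-- Each stack has at most `l` bits, so its number is below `2 ^ l ≤ w.length + 2` and fits a pebble
position. -/
theorem big_shift_right {t : Track k B Γ} (hl : 2 ^ l ≤ w.length + 2) (ht : col t + 1 < l) :
    Big (pebbleDevice N w) (shift e false t) (simState e w l q off pending b col h)
      (simState e w l q off pending b (Function.update col t (col t + 1)) h) := by
  have hr := rightVal_lt (b t) (col t + 1) (l - (col t + 1))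
  have hr' : 2 ^ (l - (col t + 1)) ≤ 2 ^ l := Nat.pow_le_pow_right two_pos (by omega)
  have hle := leftVal_lt (b t) (col t + 1)
  have hle' : 2 ^ (col t + 1) ≤ 2 ^ l := Nat.pow_le_pow_right two_pos (by omega)
  have hs := rightVal_step (b t) ht
  refine big_shift ?_ ?_ ?_ ?_ <;>
    simp only [regs, Function.update_self, Bool.not_false, leftVal] at * <;> omega

theorem big_shift_left {t : Track k B Γ} (hl : 2 ^ l ≤ w.length + 2) {o : ℕ}
    (ho : col t = o + 1) (ht : col t < l) :
    Big (pebbleDevice N w) (shift e true t) (simState e w l q off pending b col h)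
      (simState e w l q off pending b (Function.update col t o) h) := by
  rw [ho] at ht
  have hr := rightVal_lt (b t) (o + 1) (l - (o + 1))
  have hr' : 2 ^ (l - (o + 1)) ≤ 2 ^ l := Nat.pow_le_pow_right two_pos (by omega)
  have hle := leftVal_lt (b t) (o + 1)
  have hle' : 2 ^ (o + 1) ≤ 2 ^ l := Nat.pow_le_pow_right two_pos (by omega)
  have hs := rightVal_step (b t) ht
  refine big_shift ?_ ?_ ?_ ?_ <;>
    simp only [regs, Function.update_self, Bool.not_true, leftVal, ho] at * <;> omega

variable (e) [Finite Γ]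

/-- A list of the tracks of a tape. -/
noncomputable def trackList (B : ℕ) (Γ : Type) [Finite Γ] : List (Option (Fin (B + 1) × Γ)) :=
  (Finite.exists_univ_list (Option (Fin (B + 1) × Γ))).choose

theorem nodup_trackList : (trackList B Γ).Nodup :=
  (Finite.exists_univ_list (Option (Fin (B + 1) × Γ))).choose_spec.1

theorem mem_trackList (t : Option (Fin (B + 1) × Γ)) : t ∈ trackList B Γ :=
  (Finite.exists_univ_list (Option (Fin (B + 1) × Γ))).choose_spec.2 t

/-- Move the scanned column of work tape `j`. -/
noncomputable def shiftTape (d : Bool) (j : Fin k) : PebbleProg α (SimMem Q Γ k B) N :=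
  forEach (trackList B Γ) fun t => shift e d (j, t)

variable {e}

/-- The tracks of a tape move one after another, so halfway through they scan different columns.
This is why `col` depends on the track and not only on the tape. -/
theorem big_shiftTape {d : Bool} {j : Fin k} {c : Fin k → ℕ} {o : ℕ}
    (hshift : ∀ (col : Track k B Γ → ℕ) t, col (j, t) = c j →
      Big (pebbleDevice N w) (shift e d (j, t)) (simState e w l q off pending b col h)
        (simState e w l q off pending b (Function.update col (j, t) o) h)) :
    Big (pebbleDevice N w) (shiftTape e d j)
      (simState e w l q off pending b (fun t => c t.1) h)
      (simState e w l q off pending b (fun t => Function.update c j o t.1) h) := by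
  have := big_forEach (d := pebbleDevice N w) (l := trackList B Γ)
    (p := fun t => shift (α := α) (Q := Q) e d (j, t))
    (fun l' => simState e w l q off pending b
      (fun t => if t.1 = j ∧ t.2 ∈ l' then o else c t.1) h) ?_
  · have h₁ : (fun t : Track k B Γ => if t.1 = j ∧ t.2 ∈ trackList B Γ then o else c t.1) =
        fun t => Function.update c j o t.1 := by
      funext t
      by_cases ht : t.1 = j
      · simp [ht, mem_trackList]
      · simp [ht]
    simp only [List.not_mem_nil, and_false, if_false, h₁] at this
    exact this
  · intro l₁ t l₂ hl
    have hnd := nodup_trackList (B := B) (Γ := Γ)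
    rw [hl] at hnd
    have ht : t ∉ l₁ := fun ht => (List.nodup_append.1 hnd).2.2 t ht t (by simp) rfl
    convert hshift _ t ?_ using 2
    · funext t'
      by_cases h : t' = (j, t)
      · subst h; simp
      · rw [Function.update_of_ne h]
        have : t'.1 = j → t'.2 ≠ t := fun h₁ h₂ => h (Prod.ext h₁ h₂)
        by_cases h₁ : t'.1 = j <;> simp [h₁, this]
    · simp [ht]

end Simulation

/-! ### Work tapes as tracks, and the moves of the work heads -/

namespace Simulation

open Prog Classical

variable {α : Type*} {Q Γ : Type} {k B N : ℕ} {w : List α}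
  (e : SimReg k B Γ ≃ Fin N)

/-- The tracks that correspond to the contents of the work tapes. -/
noncomputable def contents (blank : Γ) (tape : Fin k → ℕ → Γ) : Track k B Γ → ℕ → Bool
  | (_, none), i => decide (i = 0)
  | (j, some (c, γ)), i => decide (tape j ((B + 1) * i + c) = γ ∧ γ ≠ blank)

/-- The state of the simulation for given contents of the work tapes and given positions of the
heads. -/
noncomputable def cfgState (w : List α) (l : ℕ) (blank : Γ) (q : Q) (pending : Fin k → Move)
    (tape : Fin k → ℕ → Γ) (pos : Fin k → ℕ) (h : ℕ) : SimMem Q Γ k B × PebbleStore α N w :=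
  simState e w l q (fun j => ⟨pos j % (B + 1), Nat.mod_lt _ B.succ_pos⟩) pending
    (contents blank tape) (fun t => pos t.1 / (B + 1)) h

/-- Change the position of a work head in the scanned column. -/
def setOff (j : Fin k) (c : Move → Fin (B + 1) → Fin (B + 1)) :
    PebbleProg α (SimMem Q Γ k B) N :=
  .act fun f _ => {({ f with off := Function.update f.off j (c (f.pending j) (f.off j)) }, none)}

/-- The movement of a work head within a column. -/
def moveInColumn : Move → Fin (B + 1) → Fin (B + 1)
  | Move.left, c => ⟨c.val - 1, by omega⟩
  | Move.stay, c => c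
  | Move.right, c => ⟨min (c.val + 1) B, by omega⟩

variable {e}

theorem big_setOff {l : ℕ} {q : Q} {off : Fin k → Fin (B + 1)} {pending : Fin k → Move}
    {b : Track k B Γ → ℕ → Bool} {col : Track k B Γ → ℕ} {h : ℕ} (j : Fin k)
    (c : Move → Fin (B + 1) → Fin (B + 1)) :
    Big (pebbleDevice N w) (setOff j c) (simState e w l q off pending b col h)
      (simState e w l q (Function.update off j (c (pending j) (off j))) pending b col h) :=
  big_act.2 ⟨none, rfl, rfl⟩

/-- The symbols that are scanned by the work heads. -/
noncomputable def readSymbols (blank : Γ) (f : SimMem Q Γ k B) (j : Fin k) : Γ :=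
  if h : ∃ γ, f.bits (j, some (f.off j, γ)) = true then h.choose else blank

/-- The marks of the scanned columns after the work heads have written `g`. -/
noncomputable def writeSymbols (blank : Γ) (f : SimMem Q Γ k B) (g : Fin k → Γ) :
    Track k B Γ → Bool
  | (j, none) => f.bits (j, none)
  | (j, some (c, γ)) => if c = f.off j then decide (g j = γ ∧ γ ≠ blank)
      else f.bits (j, some (c, γ))

/-- At most one symbol is marked at the scanned place, and none is marked for a blank. -/
theorem readSymbols_cfgState {l : ℕ} {blank : Γ} {q : Q} {pending : Fin k → Move}
    {tape : Fin k → ℕ → Γ} {pos : Fin k → ℕ} {h : ℕ} :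
    readSymbols blank (cfgState e w l blank q pending tape pos h).1 =
      fun j => tape j (pos j) := by
  funext j
  have hb : ∀ γ, (cfgState e w l blank q pending tape pos h).1.bits
      (j, some ((cfgState e w l blank q pending tape pos h).1.off j, γ)) = true ↔
      tape j (pos j) = γ ∧ γ ≠ blank := by
    intro γ
    simp only [cfgState, simState, contents, Nat.div_add_mod, decide_eq_true_eq]
  unfold readSymbols
  simp only [hb]
  split_ifs with hγ
  · exact hγ.choose_spec.1.symm
  · push Not at hγ
    exact (hγ _ rfl).symm

theorem cfgState_write {l : ℕ} {blank : Γ} {q q' : Q} {pending pending' : Fin k → Move}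
    {tape : Fin k → ℕ → Γ} {pos : Fin k → ℕ} {h : ℕ} (g : Fin k → Γ) (c : Cell w) :
    ((⟨q', (cfgState e w l blank q pending tape pos h).1.off,
        writeSymbols blank (cfgState e w l blank q pending tape pos h).1 g, pending'⟩,
      regStore e w (Function.update (regs l (contents blank tape) (fun t => pos t.1 / (B + 1)) h)
        (.inl false) c.val)) : SimMem Q Γ k B × PebbleStore α N w) =
    cfgState e w l blank q' pending' (fun j => Function.update (tape j) (pos j) (g j)) pos
      c.val := by
  -- Writing affects the scanned columns only; their bits are in the finite memory, so all stacks
  -- stay unchanged.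
  have hne : ∀ (t : Track k B Γ) i, i ≠ pos t.1 / (B + 1) →
      contents blank tape t i =
        contents blank (fun j => Function.update (tape j) (pos j) (g j)) t i := by
    rintro ⟨j, _ | ⟨o, γ⟩⟩ i hi
    · rfl
    · have hp : (B + 1) * i + o.val ≠ pos j := by
        rintro h
        refine hi ?_
        dsimp only
        rw [← h, Nat.mul_add_div B.succ_pos, Nat.div_eq_of_lt o.isLt, Nat.add_zero]
      simp only [contents, Function.update_of_ne hp]
  unfold cfgState simState
  congr 2
  · funext t
    obtain ⟨j, _ | ⟨o, γ⟩⟩ := t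
    · rfl
    · simp only [writeSymbols, contents]
      by_cases ho : o = ⟨pos j % (B + 1), Nat.mod_lt _ B.succ_pos⟩
      · subst ho
        simp [Nat.div_add_mod]
      · have hp : (B + 1) * (pos j / (B + 1)) + o.val ≠ pos j := by
          intro h
          apply ho
          apply Fin.ext
          have := congrArg (· % (B + 1)) h
          simpa [Nat.mul_add_mod, Nat.mod_eq_of_lt o.isLt] using this
        simp only [if_neg ho, Function.update_of_ne hp]
  · funext r
    rcases r with (_ | _) | ⟨_ | _, t⟩
    · simp [regs]
    · simp [regs]
    · rw [Function.update_of_ne (by simp)]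
      exact leftVal_congr fun i hi => hne t i (Nat.ne_of_lt hi)
    · rw [Function.update_of_ne (by simp)]
      exact rightVal_congr fun i hi => hne t i (Nat.ne_of_gt hi)

variable (e) [Finite Γ]

/-- Move the head of work tape `j`. -/
noncomputable def moveTape (j : Fin k) : PebbleProg α (SimMem Q Γ k B) N :=
  .ite (fun f _ => f.pending j = Move.right ∧ f.off j = Fin.last B)
    (.seq (setOff j fun _ _ => 0) (shiftTape e false j))
    (.ite (fun f _ => f.pending j = Move.left ∧ f.off j = 0 ∧ f.bits (j, none) = false)
      (.seq (setOff j fun _ _ => Fin.last B) (shiftTape e true j))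
      (setOff j moveInColumn))

theorem det_shiftTape (d : Bool) (j : Fin k) :
    (shiftTape e d j : PebbleProg α (SimMem Q Γ k B) N).Det :=
  det_forEach fun _ => det_shift e _ _

theorem det_moveTape (j : Fin k) : (moveTape e j : PebbleProg α (SimMem Q Γ k B) N).Det :=
  ⟨⟨fun _ _ => Set.subsingleton_singleton, det_shiftTape e _ _⟩,
    ⟨fun _ _ => Set.subsingleton_singleton, det_shiftTape e _ _⟩,
    fun _ _ => Set.subsingleton_singleton⟩

variable {e}

theorem big_moveTape {l : ℕ} {blank : Γ} {q : Q} {pending : Fin k → Move} {tape : Fin k → ℕ → Γ}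
    {pos : Fin k → ℕ} {h : ℕ} (hl : 2 ^ l ≤ w.length + 2) (j : Fin k)
    (hj : pos j < (B + 1) * l) (hj' : (pending j).onWork (pos j) < (B + 1) * l) :
    Big (pebbleDevice N w) (moveTape e j) (cfgState e w l blank q pending tape pos h)
      (cfgState e w l blank q pending tape
        (Function.update pos j ((pending j).onWork (pos j))) h) := by
  generalize hp' : (pending j).onWork (pos j) = p' at *
  obtain ⟨c, o, ho, hp⟩ : ∃ c o, o < B + 1 ∧ pos j = (B + 1) * c + o :=
    ⟨pos j / (B + 1), pos j % (B + 1), Nat.mod_lt _ B.succ_pos, (Nat.div_add_mod _ _).symm⟩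
  have div_eq : ∀ {c o : ℕ}, o < B + 1 → ((B + 1) * c + o) / (B + 1) = c := fun {c o} h => by
    rw [Nat.mul_add_div B.succ_pos, Nat.div_eq_of_lt h, Nat.add_zero]
  have mod_eq : ∀ {c o : ℕ}, o < B + 1 → ((B + 1) * c + o) % (B + 1) = o := fun {c o} h => by
    rw [Nat.mul_add_mod, Nat.mod_eq_of_lt h]
  have lt_of : ∀ {c o : ℕ}, (B + 1) * c + o < (B + 1) * l → c < l := fun {c o} h => by
    by_contra h'
    have := Nat.mul_le_mul_left (B + 1) (not_lt.1 h')
    omega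
  have hcl : c < l := lt_of (hp ▸ hj)
  -- The state after the move, in terms of the new column `c'` and the new place `o'` in it.
  have target : ∀ {c' o' : ℕ} (ho' : o' < B + 1), p' = (B + 1) * c' + o' →
      cfgState e w l blank q pending tape (Function.update pos j p') h =
      simState e w l q (Function.update (fun j => ⟨pos j % (B + 1), Nat.mod_lt _ B.succ_pos⟩) j
          ⟨o', ho'⟩) pending (contents blank tape)
        (fun t => Function.update (fun j => pos j / (B + 1)) j c' t.1) h := by
    intro c' o' ho' hpo
    unfold cfgState
    congr 1
    · funext i
      by_cases hi : i = j
      · subst hi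
        simp [hpo, mod_eq ho']
      · simp [hi]
    · funext t
      by_cases hi : t.1 = j
      · rw [hi, Function.update_self, Function.update_self, hpo, div_eq ho']
      · rw [Function.update_of_ne hi, Function.update_of_ne hi]
  have hoff : (⟨pos j % (B + 1), Nat.mod_lt _ B.succ_pos⟩ : Fin (B + 1)) = ⟨o, ho⟩ :=
    Fin.ext (by rw [hp]; exact mod_eq ho)
  have hcol : pos j / (B + 1) = c := by rw [hp, div_eq ho]
  by_cases h₁ : pending j = Move.right ∧ o = B
  · obtain ⟨hr, rfl⟩ := h₁
    rw [hr, Move.onWork, hp] at hp'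
    have hpo : p' = (o + 1) * (c + 1) + 0 := by rw [← hp']; ring
    refine .iteTrue ⟨hr, ?_⟩ (.seq (big_setOff j _) ?_)
    · exact hoff
    · rw [target o.succ_pos hpo]
      refine big_shiftTape (c := fun j => pos j / (o + 1)) fun col t ht => ?_
      replace ht : col (j, t) = c := ht.trans hcol
      have := big_shift_right (w := w) (e := e) (q := q) (b := contents blank tape) (h := h)
        (off := Function.update (fun j => ⟨pos j % (o + 1), Nat.mod_lt _ o.succ_pos⟩) j 0)
        (pending := pending) (t := (j, t)) (col := col) hl (by rw [ht]; exact lt_of (hpo ▸ hj'))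
      rw [ht] at this
      exact this
  · refine .iteFalse (fun hn => h₁ ⟨hn.1, ?_⟩) ?_
    · have := hoff.symm.trans hn.2
      exact congrArg Fin.val this
    -- In column `0` a left move from place `0` must stay; the marker track reveals this column.
    by_cases h₂ : pending j = Move.left ∧ o = 0 ∧ c ≠ 0
    · obtain ⟨hr, rfl, hc⟩ := h₂
      obtain ⟨c, rfl⟩ := Nat.exists_eq_succ_of_ne_zero hc
      rw [hr, Move.onWork, hp] at hp'
      have hpo : p' = (B + 1) * c + B := by rw [← hp', Nat.mul_succ]; omega
      refine .iteTrue ⟨hr, hoff, ?_⟩ (.seq (big_setOff j _) ?_)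
      · simp only [cfgState, simState, contents, hcol]
        simp
      · rw [target B.lt_succ_self hpo]
        refine big_shiftTape (c := fun j => pos j / (B + 1)) fun col t ht => ?_
        replace ht : col (j, t) = c + 1 := ht.trans hcol
        exact big_shift_left hl ht (by rw [ht]; exact hcl)
    · refine .iteFalse (fun hn => h₂ ⟨hn.1, ?_, ?_⟩) ?_
      · have := hoff.symm.trans hn.2.1
        exact congrArg Fin.val this
      · have := hn.2.2
        simp only [cfgState, simState, contents, hcol] at this
        simpa using this
      · have ht : ∃ o', ∃ ho' : o' < B + 1, p' = (B + 1) * c + o' ∧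
            moveInColumn (pending j) ⟨o, ho⟩ = ⟨o', ho'⟩ := by
          rw [hp] at hp'
          cases hm : pending j with
          | left =>
            rw [hm] at hp'
            refine ⟨o - 1, by omega, ?_, rfl⟩
            rw [← hp', Move.onWork]
            -- In the leftmost column, truncated subtraction gives the move that leaves the head on
            -- cell `0`.
            by_cases hc : c = 0
            · subst hc; omega
            · have : o ≠ 0 := fun h => h₂ ⟨hm, h, hc⟩
              omega
          | stay =>
            rw [hm] at hp'
            exact ⟨o, ho, hp'.symm, rfl⟩
          | right =>
            rw [hm] at hp'
            have : o ≠ B := fun h => h₁ ⟨hm, h⟩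
            refine ⟨o + 1, by omega, ?_, ?_⟩
            · rw [← hp', Move.onWork, Nat.add_assoc]
            · simp only [moveInColumn, Fin.mk.injEq]
              omega
        obtain ⟨o', ho', hpo, hm⟩ := ht
        rw [target ho' hpo]
        have := big_setOff (w := w) (e := e) (l := l) (q := q) (pending := pending)
          (off := fun j => ⟨pos j % (B + 1), Nat.mod_lt _ B.succ_pos⟩)
          (b := contents blank tape) (col := fun t => pos t.1 / (B + 1)) (h := h) j moveInColumn
        rw [hoff, hm] at this
        rw [← hcol, Function.update_eq_self]
        exact this

variable (e)

/-- Move all work heads. -/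
noncomputable def moveTapes : PebbleProg α (SimMem Q Γ k B) N :=
  forEach (List.finRange k) (moveTape e)

theorem det_moveTapes : (moveTapes e : PebbleProg α (SimMem Q Γ k B) N).Det :=
  det_forEach (det_moveTape e)

variable {e}

theorem big_moveTapes {l : ℕ} {blank : Γ} {q : Q} {pending : Fin k → Move}
    {tape : Fin k → ℕ → Γ} {pos : Fin k → ℕ} {h : ℕ} (hl : 2 ^ l ≤ w.length + 2)
    (hj : ∀ j, pos j < (B + 1) * l) (hj' : ∀ j, (pending j).onWork (pos j) < (B + 1) * l) :
    Big (pebbleDevice N w) (moveTapes e) (cfgState e w l blank q pending tape pos h)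
      (cfgState e w l blank q pending tape (fun j => (pending j).onWork (pos j)) h) := by
  have := big_forEach (d := pebbleDevice N w) (l := List.finRange k)
    (p := moveTape (α := α) (Q := Q) e)
    (fun l' => cfgState e w l blank q pending tape
      (fun j => if j ∈ l' then (pending j).onWork (pos j) else pos j) h) ?_
  · rw [moveTapes]
    simpa using this
  · intro l₁ j l₂ hl'
    have hnd := List.nodup_finRange k
    rw [hl'] at hnd
    have hj₁ : j ∉ l₁ := fun ht => (List.nodup_append.1 hnd).2.2 j ht j (by simp) rfl
    have := big_moveTape (w := w) (e := e) (blank := blank) (q := q) (tape := tape) (h := h)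
      (pending := pending) (pos := fun j => if j ∈ l₁ then (pending j).onWork (pos j) else pos j)
      hl j (by simp [hj₁, hj]) (by simp [hj₁, hj'])
    convert this using 2
    funext i
    by_cases hi : i = j
    · subst hi; simp [hj₁]
    · simp [hi]

end Simulation

/-! ### The pebble automaton that simulates a Turing machine -/

namespace TuringMachine

open Prog Simulation Classical

variable {α : Type*} {k : ℕ} (M : TuringMachine α k) {B N : ℕ} {w : List α}
  (e : SimReg k B M.Γ ≃ Fin N)

/-- Perform the part of a transition that does not move the work heads. -/
noncomputable def chooseTransition : PebbleProg α (SimMem M.Q M.Γ k B) N :=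
  movePebble (e (.inl false)) fun f a => {r | ∃ p g ε η,
    (p, g, ε, η) ∈ M.δ f.state a (readSymbols M.blank f) ∧
      r = (⟨p, f.off, writeSymbols M.blank f g, η⟩, ε)}

/-- The simulation of one step. -/
noncomputable def simulateStep [Finite M.Γ] : PebbleProg α (SimMem M.Q M.Γ k B) N :=
  .seq (M.chooseTransition e) (moveTapes e)

/-- The simulation of a Turing machine. -/
noncomputable def simulation [Finite M.Γ] : PebbleProg α (SimMem M.Q M.Γ k B) N :=
  .seq dropPebbles (.loop (fun f _ => f.state ∉ M.accept) (M.simulateStep e))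

theorem det_simulation [Finite M.Γ] (hM : M.IsDeterministic) : (M.simulation e).Det := by
  refine ⟨det_dropPebbles, det_movePebble ?_, det_moveTapes e⟩
  rintro f a r ⟨p, g, ε, η, h, rfl⟩ r' ⟨p', g', ε', η', h', rfl⟩
  cases hM _ _ _ h h'
  rfl

variable {M}

/-- The effect of a transition on a configuration. -/
def Cfg.apply (x : M.Cfg w) (p : M.Q) (g : Fin k → M.Γ) (ε : Move) (η : Fin k → Move) :
    M.Cfg w where
  state := p
  head := ε.onInput x.head
  workHead := fun j => (η j).onWork (x.workHead j)
  tape := fun j => Function.update (x.tape j) (x.workHead j) (g j)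

theorem step_iff (x x' : M.Cfg w) : M.Step w x x' ↔ ∃ p g ε η,
    (p, g, ε, η) ∈ M.δ x.state (scan w x.head) (fun j => x.tape j (x.workHead j)) ∧
      x' = x.apply p g ε η := by
  unfold Step Cfg.apply
  refine exists_congr fun p => exists_congr fun g => exists_congr fun ε => exists_congr fun η =>
    and_congr Iff.rfl ?_
  obtain ⟨q, h, b, t⟩ := x'
  rw [Cfg.mk.injEq, funext_iff, funext_iff]

/-- The relation between the reachable configurations of a Turing machine and the states of the
program that simulates it. -/
def Represents (l : ℕ) (x : M.Cfg w) (s : SimMem M.Q M.Γ k B × PebbleStore α N w) : Prop :=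
  M.Reachable w x ∧ ∃ pending,
    s = cfgState e w l M.blank x.state pending x.tape x.workHead x.head.val

variable {e}

theorem big_chooseTransition {l : ℕ} (x : M.Cfg w) (pending : Fin k → Move)
    {s' : SimMem M.Q M.Γ k B × PebbleStore α N w} :
    Big (pebbleDevice N w) (M.chooseTransition e)
      (cfgState e w l M.blank x.state pending x.tape x.workHead x.head.val) s' ↔
    ∃ p g ε η, (p, g, ε, η) ∈ M.δ x.state (scan w x.head) (fun j => x.tape j (x.workHead j)) ∧
      s' = cfgState e w l M.blank p η (x.apply p g ε η).tape x.workHead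
        (x.apply p g ε η).head.val := by
  have hh : (⟨min (regs l (contents M.blank x.tape) (fun t => x.workHead t.1 / (B + 1))
      x.head.val (e.symm (e (.inl false)))) (w.length + 1), by omega⟩ : Cell w) = x.head := by
    have := x.head.isLt
    apply Fin.ext
    simp [regs]
    omega
  have hupd (ε : Move) := update_regStore (w := w) (e := e)
    (regs l (contents M.blank x.tape) (fun t => x.workHead t.1 / (B + 1)) x.head.val)
    (.inl false) (ε.onInput x.head) (ε.onInput x.head).val (by omega)
  have key := big_movePebble (w := w) (r := e (.inl false))
    (u := fun f a => {r | ∃ p g ε η, (p, g, ε, η) ∈ M.δ f.state a (readSymbols M.blank f) ∧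
      r = ((⟨p, f.off, writeSymbols M.blank f g, η⟩ : SimMem M.Q M.Γ k B), ε)})
    (f := (cfgState e w l M.blank x.state pending x.tape x.workHead x.head.val).1)
    (v := fun i => ⟨min (regs l (contents M.blank x.tape) (fun t => x.workHead t.1 / (B + 1))
      x.head.val (e.symm i)) (w.length + 1), by omega⟩) (s' := s')
  rw [hh, readSymbols_cfgState] at key
  refine Iff.trans key ?_
  constructor
  · rintro ⟨f', ε, ⟨p, g, ε, η, h, e⟩, rfl⟩
    cases e
    refine ⟨p, g, ε, η, h, ?_⟩
    rw [hupd]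
    exact cfgState_write g _
  · rintro ⟨p, g, ε, η, h, rfl⟩
    refine ⟨_, ε, ⟨p, g, ε, η, h, rfl⟩, ?_⟩
    rw [hupd]
    exact (cfgState_write g _).symm

theorem Represents.simulateStep [Finite M.Γ] {l : ℕ} (hl : 2 ^ l ≤ w.length + 2)
    (hspace : ∀ x : M.Cfg w, M.Reachable w x → ∀ j, x.workHead j < (B + 1) * l) {x : M.Cfg w}
    {s : SimMem M.Q M.Γ k B × PebbleStore α N w} (hs : Represents e l x s) :
    (∀ s', Big (pebbleDevice N w) (M.simulateStep e) s s' →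
      ∃ x', M.Step w x x' ∧ Represents e l x' s') ∧
    (∀ x', M.Step w x x' →
      ∃ s', Big (pebbleDevice N w) (M.simulateStep e) s s' ∧ Represents e l x' s') := by
  obtain ⟨hx, pending, rfl⟩ := hs
  have key : ∀ p g ε η,
      (p, g, ε, η) ∈ M.δ x.state (scan w x.head) (fun j => x.tape j (x.workHead j)) →
      M.Step w x (x.apply p g ε η) ∧
      Big (pebbleDevice N w) (moveTapes e) (cfgState e w l M.blank p η (x.apply p g ε η).tape
        x.workHead (x.apply p g ε η).head.val) (cfgState e w l M.blank (x.apply p g ε η).state η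
          (x.apply p g ε η).tape (x.apply p g ε η).workHead (x.apply p g ε η).head.val) ∧
      M.Reachable w (x.apply p g ε η) := by
    intro p g ε η h
    have hstep := (step_iff x _).2 ⟨p, g, ε, η, h, rfl⟩
    -- The space bound covers only reachable configurations, so reachability is part of
    -- `Represents`; it is needed before and after the step.
    have hx' : M.Reachable w (x.apply p g ε η) := hx.tail hstep
    exact ⟨hstep, big_moveTapes hl (hspace x hx) (hspace _ hx'), hx'⟩
  constructor
  · intro s' h
    obtain ⟨r, hr, h⟩ := big_seq.1 h
    obtain ⟨p, g, ε, η, hδ, rfl⟩ := (big_chooseTransition x pending).1 hr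
    obtain ⟨h₁, h₂, h₃⟩ := key p g ε η hδ
    obtain rfl := h.unique (det_moveTapes e) h₂
    exact ⟨_, h₁, h₃, η, rfl⟩
  · intro x' h
    obtain ⟨p, g, ε, η, hδ, rfl⟩ := (step_iff x x').1 h
    obtain ⟨h₁, h₂, h₃⟩ := key p g ε η hδ
    exact ⟨_, .seq ((big_chooseTransition x pending).2 ⟨p, g, ε, η, hδ, rfl⟩) h₂, h₃, η, rfl⟩

/-- The initial memory for the simulation. -/
def initMem (M : TuringMachine α k) (B : ℕ) : SimMem M.Q M.Γ k B :=
  ⟨M.start, fun _ => 0, fun t => t.2.isNone, fun _ => Move.stay⟩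

/-- Blanks carry no marks, and the marker of column `0` is in the finite memory, so all registers
start at zero. -/
theorem represents_init (l : ℕ) :
    Represents e l (M.init w) (M.initMem B, (cellStore (fun _ => 0) 0 : PebbleStore α N w)) := by
  refine ⟨.refl, fun _ => Move.stay, ?_⟩
  unfold cfgState simState initMem init
  refine Prod.ext ?_ ?_
  · simp only [SimMem.mk.injEq, true_and, and_true]
    constructor
    · funext j
      simp
    · funext t
      obtain ⟨j, _ | ⟨c, γ⟩⟩ := t
      · simp [contents]
      · simp only [contents, Option.isNone_some]
        symm
        simp only [decide_eq_false_iff_not, not_and, not_not]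
        exact Eq.symm
  · dsimp only
    unfold regStore
    congr 1
    funext i
    suffices h : ∀ r, regs l (contents M.blank fun _ _ => M.blank)
        (fun t : Track k B M.Γ => 0 / (B + 1)) 0 r = 0 by
      apply Fin.ext
      simp only [Fin.val_zero]
      rw [h]
      simp
    rintro ((_ | _) | ⟨_ | _, t⟩)
    · rfl
    · rfl
    · simp [regs, leftVal]
    · refine rightVal_eq_zero fun i hi => ?_
      obtain ⟨j, _ | ⟨c, γ⟩⟩ := t
      · simp [contents]
        omega
      · simp only [contents, decide_eq_false_iff_not, not_and, not_not]
        exact Eq.symm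

theorem big_dropPebbles_init (f : SimMem M.Q M.Γ k B) :
    Big (pebbleDevice N w) dropPebbles (f, ⟨0, fun _ => none⟩)
      (f, (cellStore (fun _ => 0) 0 : PebbleStore α N w)) := by
  refine big_act.2 ⟨_, rfl, ?_⟩
  simp [Device.run, pebbleDevice, cellStore, Move.onInput]

/-- Both `Nat.log 2 n` and `1` are at most `Nat.log 2 (n + 2)`; hence the column width `2 * b + 1`.
-/
theorem space_le (b n : ℕ) : b * (Nat.log 2 n + 1) ≤ (2 * b + 1) * Nat.log 2 (n + 2) := by
  have h₁ : Nat.log 2 n ≤ Nat.log 2 (n + 2) := Nat.log_mono_right (by omega)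
  have h₂ : 1 ≤ Nat.log 2 (n + 2) := Nat.log_pos one_lt_two (by omega)
  nlinarith

variable (M)

theorem exists_pebbleAutomaton (hM : M.IsLogspace) : ∃ (m : ℕ) (P : PebbleAutomaton α m),
    (M.IsDeterministic → P.IsDeterministic) ∧ P.language = M.language := by
  have := M.finite_Q
  have := M.finite_Γ
  obtain ⟨b, hb⟩ := hM
  obtain ⟨N, ⟨e⟩⟩ := Finite.exists_equiv_fin (SimReg k (2 * b) M.Γ)
  refine ⟨N, (M.simulation e).toPebble (M.initMem (2 * b)),
    fun hM => toPebble_isDeterministic (M.det_simulation e hM), ?_⟩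
  ext w
  rw [mem_language_toPebble]
  have hl : 2 ^ Nat.log 2 (w.length + 2) ≤ w.length + 2 := Nat.pow_log_le_self 2 (by omega)
  have hspace : ∀ x : M.Cfg w, M.Reachable w x → ∀ j,
      x.workHead j < (2 * b + 1) * Nat.log 2 (w.length + 2) := fun x hx j =>
    (hb w x hx j).trans_le (space_le b w.length)
  have key := exists_big_loop_iff (d := pebbleDevice N w) (step := M.Step w)
    (acc := fun x => x.state ∈ M.accept) (Represents e (Nat.log 2 (w.length + 2)))
    (t := fun f _ => f.state ∉ M.accept) (p := M.simulateStep e) ?_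
    (fun x s s' hx => (hx.simulateStep hl hspace).1 s')
    (fun x s x' hx => (hx.simulateStep hl hspace).2 x') (represents_init _)
  · refine Iff.trans ?_ key
    refine exists_congr fun s' => ?_
    rw [simulation, big_seq]
    constructor
    · rintro ⟨r, hr, h⟩
      obtain rfl := hr.unique det_dropPebbles (big_dropPebbles_init _)
      exact h
    · exact fun h => ⟨_, big_dropPebbles_init _, h⟩
  · rintro x s ⟨-, pending, rfl⟩
    exact Iff.rfl

end TuringMachine

end PebbleLogspace

theorem mainTheorem10 (α : Type*) [Finite α] :
    (PebbleLogspace.LOGSPACE α = ⋃ m : ℕ, PebbleLogspace.REG α m) ∧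
    (PebbleLogspace.NLOGSPACE α = ⋃ m : ℕ, PebbleLogspace.NREG α m) := by
  refine ⟨Set.ext fun L => ?_, Set.ext fun L => ?_⟩
  · rw [Set.mem_iUnion]
    constructor
    · rintro ⟨k, M, hM, hlog, rfl⟩
      obtain ⟨m, P, hP, h⟩ := M.exists_pebbleAutomaton hlog
      exact ⟨m, P, hP hM, h⟩
    · rintro ⟨m, M, hM, rfl⟩
      obtain ⟨T, hT, hlog, h⟩ := M.exists_turingMachine
      exact ⟨1, T, hT hM, hlog, h⟩
  · rw [Set.mem_iUnion]
    constructor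
    · rintro ⟨k, M, hlog, rfl⟩
      obtain ⟨m, P, -, h⟩ := M.exists_pebbleAutomaton hlog
      exact ⟨m, P, h⟩
    · rintro ⟨m, M, rfl⟩
      obtain ⟨T, -, hlog, h⟩ := M.exists_turingMachine
      exact ⟨1, T, hlog, h⟩
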